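/- \textbf{Definitions.} Let $\mathbb{C}\{x,y\}$ be the ring of convergent power series. A germ of plane curve $C$ at the origin of $\mathbb{C}^2$ is given by a reduced equation $f\in\mathbb{C}\{x,y\}$, i.e. a nonzero non-unit $f$ such that the ideal $\langle f\rangle$ is radical. The valuation of a holomorphic $1$-form $\omega=a\,dx+b\,dy$, with $a,b\in\mathbb{C}\{x,y\}$, is $\nu(\omega)=\min\{\operatorname{ord}_0 a,\operatorname{ord}_0 b\}$. The Saito module of $C$ is \[\Omega^1(\log C)=\{\omega=a\,dx+b\,dy:\ \omega\wedge df\in\langle f\rangle\,dx\wedge dy\},\] and the Saito number of $C$ is $\mathfrak{s}(C)=\min_{\omega\in\Omega^1(\log C)}\nu(\omega)$. The branches of $C$ correspond to the minimal primes over $\langle f\rangle$. Put $i(I,J)=\dim_{\mathbb{C}}\mathbb{C}\{x,y\}/(I+J)$; the value semigroup of the branch with prime ideal $P$ is $\{i(P,\langle h\rangle):h\in\mathbb{C}\{x,y\}\setminus P\}$. Two germs of plane curves are equisingular if there is a bijection between their branches that preserves the value semigroups of the branches and the intersection multiplicities $i(P,Q)$ of pairs of distinct branches. For $N\geq 1$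 let $\mathrm{Top}(C_{N,1,1})$ be the class of all germs of plane curves equisingular to $C_{N,1,1}=\{y^N-x^N=0\}$, that is, the class of unions of $N$ smooth, pairwise transversal branches. \textbf{Proposition.} Let $N>1$. The maximum \[\mathfrak{M}_N=\max_{C\in\mathrm{Top}(C_{N,1,1})}\mathfrak{s}(C)\] exists and is given by \[\mathfrak{M}_N=\begin{cases}1 & \text{if } N\in\{2,3,4\},\\ \frac{N-1}{2} & \text{if } N\geq 5 \text{ is odd},\\ \frac{N}{2}-1 & \text{if } N\geq 5\text{ is even.}\end{cases}\] Moreover, for every integer $k\in\{1,\dots,\mathfrak{M}_N\}$ there exists $C\in\mathrm{Top}(C_{N,1,1})$ such that $\mathfrak{s}(C)=k$. -/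

import Mathlib

namespace PlaneCurve

noncomputable section

/-- A power series in two variables with complex coefficients converges near the origin:
it converges absolutely on some closed polydisc of positive radius. -/
def IsConvergent (f : MvPowerSeries (Fin 2) ℂ) : Prop :=
  ∃ r : ℝ, 0 < r ∧ Summable fun n : Fin 2 →₀ ℕ => ‖MvPowerSeries.coeff n f‖ * r ^ n.degree

theorem isConvergent_coe (p : MvPolynomial (Fin 2) ℂ) :
    IsConvergent (p : MvPowerSeries (Fin 2) ℂ) := by
  refine ⟨1, one_pos, summable_of_hasFiniteSupport (p.support.finite_toSet.subset ?_)⟩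
  intro n hn
  by_contra h
  apply hn
  have : MvPolynomial.coeff n p = 0 := by simpa using h
  simp [MvPolynomial.coeff_coe, this]

theorem summable_of_le {f : MvPowerSeries (Fin 2) ℂ} {r s : ℝ} (hs : 0 < s) (h : s ≤ r)
    (hf : Summable fun n : Fin 2 →₀ ℕ => ‖MvPowerSeries.coeff n f‖ * r ^ n.degree) :
    Summable fun n : Fin 2 →₀ ℕ => ‖MvPowerSeries.coeff n f‖ * s ^ n.degree :=
  Summable.of_nonneg_of_le (fun n => by positivity) (fun n => by gcongr) hf

theorem IsConvergent.add {f g : MvPowerSeries (Fin 2) ℂ} (hf : IsConvergent f)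
    (hg : IsConvergent g) : IsConvergent (f + g) := by
  obtain ⟨r, hr, hf⟩ := hf
  obtain ⟨s, hs, hg⟩ := hg
  have ht : 0 < min r s := lt_min hr hs
  refine ⟨min r s, ht, Summable.of_nonneg_of_le (fun n => by positivity) (fun n => ?_)
    ((summable_of_le ht (min_le_left _ _) hf).add (summable_of_le ht (min_le_right _ _) hg))⟩
  rw [map_add, ← add_mul]
  gcongr
  exact norm_add_le _ _

theorem IsConvergent.mul {f g : MvPowerSeries (Fin 2) ℂ} (hf : IsConvergent f)
    (hg : IsConvergent g) : IsConvergent (f * g) := by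
  classical
  obtain ⟨r, hr, hf⟩ := hf
  obtain ⟨s, hs, hg⟩ := hg
  have ht : 0 < min r s := lt_min hr hs
  refine ⟨min r s, ht, ?_⟩
  have hF := summable_of_le ht (min_le_left _ _) hf
  have hG := summable_of_le ht (min_le_right _ _) hg
  generalize min r s = t at ht hF hG ⊢
  let F : (Fin 2 →₀ ℕ) → ℝ := fun n => ‖MvPowerSeries.coeff n f‖ * t ^ n.degree
  let G : (Fin 2 →₀ ℕ) → ℝ := fun n => ‖MvPowerSeries.coeff n g‖ * t ^ n.degree
  have hFG : Summable fun p : (Fin 2 →₀ ℕ) × (Fin 2 →₀ ℕ) => F p.1 * G p.2 :=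
    Summable.mul_of_nonneg (f := F) (g := G) hF hG
      (fun n => mul_nonneg (norm_nonneg _) (pow_nonneg ht.le _))
      (fun n => mul_nonneg (norm_nonneg _) (pow_nonneg ht.le _))
  have h : Summable fun n => ∑ p ∈ Finset.HasAntidiagonal.antidiagonal n, F p.1 * G p.2 :=
    summable_sum_mul_antidiagonal_of_summable_mul hFG
  refine Summable.of_nonneg_of_le
    (fun n => mul_nonneg (norm_nonneg _) (pow_nonneg ht.le _)) (fun n => ?_) h
  rw [MvPowerSeries.coeff_mul]
  refine (mul_le_mul_of_nonneg_right (norm_sum_le _ _) (pow_nonneg ht.le _)).trans ?_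
  rw [Finset.sum_mul]
  refine Finset.sum_le_sum fun p hp => le_of_eq ?_
  rw [← Finset.HasAntidiagonal.mem_antidiagonal.mp hp, map_add, pow_add, norm_mul]
  simp only [F, G]
  ring

theorem IsConvergent.pderiv {f : MvPowerSeries (Fin 2) ℂ} (hf : IsConvergent f) (i : Fin 2) :
    IsConvergent (MvPowerSeries.pderiv ℂ i f) := by
  obtain ⟨r, hr, hf⟩ := hf
  refine ⟨r / 2, by positivity, ?_⟩
  have hinj : Function.Injective fun n : Fin 2 →₀ ℕ => n + Finsupp.single i 1 :=
    add_left_injective _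
  refine Summable.of_nonneg_of_le (fun n => by positivity) (fun n => ?_)
    ((hf.comp_injective hinj).mul_right r⁻¹)
  have hn : (n i : ℝ) + 1 ≤ 2 ^ n.degree := by
    have h1 : n i ≤ n.degree := Finsupp.le_degree i n
    have h2 : n.degree < 2 ^ n.degree := Nat.lt_two_pow_self
    exact_mod_cast (by omega : n i + 1 ≤ 2 ^ n.degree)
  have hnorm : ‖((n i : ℂ) + 1)‖ = (n i : ℝ) + 1 := by
    rw [← Nat.cast_succ, Complex.norm_natCast, Nat.cast_succ]
  rw [MvPowerSeries.coeff_pderiv, norm_mul, hnorm, Function.comp_apply, map_add,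
    Finsupp.degree_single, pow_succ, div_pow]
  have : ‖MvPowerSeries.coeff (n + Finsupp.single i 1) f‖ * (r ^ n.degree * r) * r⁻¹ =
      ‖MvPowerSeries.coeff (n + Finsupp.single i 1) f‖ * (2 ^ n.degree) *
        (r ^ n.degree / 2 ^ n.degree) := by
    field_simp
  rw [this]
  gcongr

/-- The ring `ℂ{x, y}` of convergent power series in two variables, as a `ℂ`-algebra. -/
def ConvSeries : Subalgebra ℂ (MvPowerSeries (Fin 2) ℂ) where
  carrier := {f | IsConvergent f}
  mul_mem' := IsConvergent.mul
  add_mem' := IsConvergent.add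
  algebraMap_mem' a := by
    simpa [MvPowerSeries.algebraMap_apply] using isConvergent_coe (MvPolynomial.C a)

/-- The coordinate function `x`. -/
def x : ConvSeries :=
  ⟨MvPowerSeries.X 0, by
    have h := isConvergent_coe (MvPolynomial.X 0)
    rwa [MvPolynomial.coe_X] at h⟩

/-- The coordinate function `y`. -/
def y : ConvSeries :=
  ⟨MvPowerSeries.X 1, by
    have h := isConvergent_coe (MvPolynomial.X 1)
    rwa [MvPolynomial.coe_X] at h⟩

/-- Partial derivatives on `ℂ{x, y}`: index `0` is `∂/∂x`, index `1` is `∂/∂y`. -/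
def partialDeriv (i : Fin 2) (f : ConvSeries) : ConvSeries :=
  ⟨MvPowerSeries.pderiv ℂ i f, IsConvergent.pderiv f.2 i⟩

/-- The module `Ω¹` of germs of holomorphic `1`-forms at the origin of `ℂ²`, free with basis
`dx, dy`: the pair `(a, b)` stands for `a dx + b dy`. -/
abbrev OneForm : Type := ConvSeries × ConvSeries

/-- The differential `df = (∂f/∂x) dx + (∂f/∂y) dy`. -/
def differential (f : ConvSeries) : OneForm := (partialDeriv 0 f, partialDeriv 1 f)

/-- Exterior product with a fixed `1`-form `η = c dx + e dy`, where a `2`-form is identified with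
its coefficient with respect to `dx ∧ dy`: `(a dx + b dy) ∧ (c dx + e dy) = (a e - b c) dx ∧ dy`. -/
def wedge (η : OneForm) : OneForm →ₗ[ConvSeries] ConvSeries where
  toFun ω := ω.1 * η.2 - ω.2 * η.1
  map_add' ω ω' := by simp only [Prod.fst_add, Prod.snd_add]; ring
  map_smul' c ω := by
    simp only [Prod.smul_fst, Prod.smul_snd, smul_eq_mul, RingHom.id_apply]; ring

/-- The valuation (multiplicity at the origin) of a `1`-form: the minimum of the orders of its
coefficients, with value `⊤` exactly at the zero form. -/
def valuation (ω : OneForm) : ℕ∞ :=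
  min (MvPowerSeries.order (ω.1 : MvPowerSeries (Fin 2) ℂ))
    (MvPowerSeries.order (ω.2 : MvPowerSeries (Fin 2) ℂ))

/-- The Saito module `Ω¹(log C)` of the curve `C = {f = 0}`:
the `1`-forms `ω` with `ω ∧ df ∈ ⟨f⟩`. -/
def saitoModule (f : ConvSeries) : Submodule ConvSeries OneForm :=
  Submodule.comap (wedge (differential f)) (Ideal.span {f})

/-- The Saito number `𝔰(C)` of the curve `C = {f = 0}`: the minimal valuation of the elements of
its Saito module. -/
def saitoNumber (f : ConvSeries) : ℕ∞ :=
  sInf (valuation '' (saitoModule f : Set OneForm))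

/-- `f` is a reduced equation of a germ of plane curve at the origin: it is nonzero, it vanishes
at the origin (it is not a unit) and the ideal it generates is radical. -/
structure IsReducedEquation (f : ConvSeries) : Prop where
  ne_zero : f ≠ 0
  not_isUnit : ¬ IsUnit f
  isRadical : (Ideal.span {f}).IsRadical

/-- The branches (irreducible components) of the curve `{f = 0}`, given by their prime ideals:
the minimal primes over `⟨f⟩`. -/
abbrev Branch (f : ConvSeries) : Type := (Ideal.span {f}).minimalPrimes

/-- The intersection multiplicity at the origin `dim_ℂ ℂ{x, y} / (I + J)`
of the germs defined by `I` and `J`. -/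
def intersectionMultiplicity (I J : Ideal ConvSeries) : ℕ :=
  Module.finrank ℂ (ConvSeries ⧸ (I ⊔ J))

/-- The value semigroup of the branch with prime ideal `P`: all intersection multiplicities of
the branch with curves `{h = 0}` not containing it. -/
def valueSemigroup (P : Ideal ConvSeries) : Set ℕ :=
  {m | ∃ h : ConvSeries, h ∉ P ∧ intersectionMultiplicity P (Ideal.span {h}) = m}

/-- Equisingularity (Zariski) of the plane curve germs with reduced equations `f` and `g`:
there is a bijection between their branches that preserves the value semigroups of the branches
and the intersection multiplicities of the pairs of distinct branches. -/
def Equisingular (f g : ConvSeries) : Prop :=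
  ∃ e : Branch f ≃ Branch g,
    (∀ P : Branch f, valueSemigroup (e P).1 = valueSemigroup P.1) ∧
    ∀ P Q : Branch f, P ≠ Q →
      intersectionMultiplicity (e P).1 (e Q).1 = intersectionMultiplicity P.1 Q.1

/-- The equation `y ^ N - x ^ N` of the curve `C_{N,1,1}`, a union of `N` distinct lines. -/
def linesEquation (N : ℕ) : ConvSeries := y ^ N - x ^ N

/-- `Top(C_{N,1,1})`: the reduced equations of all germs of plane curves that are equisingular to
the curve `y ^ N - x ^ N = 0`. -/
def topClass (N : ℕ) : Set ConvSeries :=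
  {f | IsReducedEquation f ∧ Equisingular f (linesEquation N)}

end

end PlaneCurve

/-!
The argument reduces the whole class `topClass N` to explicit families of smooth germs, bounds the
Saito number by adding the branches one at a time, and exhibits leaves of one dicritical foliation
for which the bound is attained.

*Structure.* In `ℂ{x, y}` there is a Weierstrass division by any `g` with `g(0) = 0` and
`dg(0) ≠ 0` (`exists_weierstrass_division`, a contraction on weighted `ℓ¹` norms). Hence the
quotient by `g` behaves as a discrete valuation ring whose uniformizer is a coordinate: `g` is prime
and divisibility modulo `g` is total. It follows that for `N ≥ 2` the curves in `topClass N` are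
exactly the products of `N` such `g` with pairwise independent differentials
(`IsTransversalFamily.mem_topClass`, `exists_associated_prod_of_mem_topClass`).

*Upper bound.* By induction on the branches one finds two logarithmic forms whose exterior product
is the equation of the curve (`exists_isTangent_wedge_eq_prod`), so that their valuations add up to
at most `N`. If `N = 2 m` with `m ≥ 2` and both valuations were `m`, then the leading parts
`A dx + B dy` would satisfy `x A + y B = 0`, a binary form of degree `m + 1 < N` vanishing on all
the tangents of the curve; the two leading parts would be proportional and the exterior product
would have order larger than `N`. This gives the bound `max 1 ((N - 1) / 2)`, which encodes the
three cases of the formula.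

*Examples.* The form `(x ^ (k + 1) - y ^ k) dx + x y ^ (k - 1) dy` has valuation `k` and the first
integral `(y / x) ^ k + k x`; it has one smooth leaf with tangent `y = c x` for each `c ≠ 0`, namely
`y = c x (1 - k c ^ (-k) x) ^ (1 / k)`. The union of `N` such leaves has Saito number at most `k`.
If `N ≥ 2 k + 1`, a logarithmic form of smaller valuation is excluded by looking at its first two
homogeneous parts (`le_valuation_of_isTangent`).
-/

namespace PlaneCurve

noncomputable section

open MvPowerSeries Finsupp

/-! ### Weighted norms and Weierstrass division of convergent power series -/

/-- The value of the monomial `x ^ n 0 * y ^ n 1` at the polyradius `ρ`. -/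
def monomialWeight (ρ : Fin 2 → ℝ) (n : Fin 2 →₀ ℕ) : ℝ := ρ 0 ^ n 0 * ρ 1 ^ n 1

/-- Absolute convergence of a power series on the closed polydisc of polyradius `ρ`. -/
def ConvergesAt (ρ : Fin 2 → ℝ) (f : MvPowerSeries (Fin 2) ℂ) : Prop :=
  Summable fun n => ‖coeff n f‖ * monomialWeight ρ n

/-- The weighted `ℓ¹` norm of a power series on the polydisc of polyradius `ρ`; it is meaningful
for series satisfying `ConvergesAt ρ`. -/
def polyNorm (ρ : Fin 2 → ℝ) (f : MvPowerSeries (Fin 2) ℂ) : ℝ :=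
  ∑' n, ‖coeff n f‖ * monomialWeight ρ n

theorem monomialWeight_pos {ρ : Fin 2 → ℝ} (hρ : ∀ s, 0 < ρ s) (n : Fin 2 →₀ ℕ) :
    0 < monomialWeight ρ n :=
  mul_pos (pow_pos (hρ 0) _) (pow_pos (hρ 1) _)

theorem monomialWeight_add (ρ : Fin 2 → ℝ) (m n : Fin 2 →₀ ℕ) :
    monomialWeight ρ (m + n) = monomialWeight ρ m * monomialWeight ρ n := by
  simp only [monomialWeight, Finsupp.add_apply, pow_add]; ring

theorem monomialWeight_single (ρ : Fin 2 → ℝ) (i : Fin 2) :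
    monomialWeight ρ (single i 1) = ρ i := by
  fin_cases i <;> simp [monomialWeight]

theorem monomialWeight_const (r : ℝ) (n : Fin 2 →₀ ℕ) :
    monomialWeight (fun _ => r) n = r ^ n.degree := by
  rw [monomialWeight, ← pow_add, Finsupp.degree_eq_sum, Fin.sum_univ_two]

theorem monomialWeight_mono {ρ σ : Fin 2 → ℝ} (hρ : ∀ s, 0 < ρ s) (h : ∀ s, ρ s ≤ σ s)
    (n : Fin 2 →₀ ℕ) : monomialWeight ρ n ≤ monomialWeight σ n := by
  have h0 := (hρ 0).le
  have h1 := (hρ 1).le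
  have h2 := h0.trans (h 0)
  exact mul_le_mul (pow_le_pow_left₀ h0 (h 0) _) (pow_le_pow_left₀ h1 (h 1) _)
    (by positivity) (by positivity)

theorem ConvergesAt.mono {ρ σ : Fin 2 → ℝ} (hρ : ∀ s, 0 < ρ s) (h : ∀ s, ρ s ≤ σ s)
    {f : MvPowerSeries (Fin 2) ℂ} (hf : ConvergesAt σ f) : ConvergesAt ρ f :=
  Summable.of_nonneg_of_le (fun n => mul_nonneg (norm_nonneg _) (monomialWeight_pos hρ n).le)
    (fun n => mul_le_mul_of_nonneg_left (monomialWeight_mono hρ h n) (norm_nonneg _)) hf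

theorem isConvergent_iff_exists_convergesAt_const {f : MvPowerSeries (Fin 2) ℂ} :
    IsConvergent f ↔ ∃ r : ℝ, 0 < r ∧ ConvergesAt (fun _ => r) f := by
  simp only [IsConvergent, ConvergesAt, monomialWeight_const]

theorem ConvergesAt.isConvergent {ρ : Fin 2 → ℝ} (hρ : ∀ s, 0 < ρ s)
    {f : MvPowerSeries (Fin 2) ℂ} (hf : ConvergesAt ρ f) : IsConvergent f := by
  refine isConvergent_iff_exists_convergesAt_const.2
    ⟨min (ρ 0) (ρ 1), lt_min (hρ 0) (hρ 1), hf.mono (fun _ => lt_min (hρ 0) (hρ 1)) ?_⟩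
  intro s
  fin_cases s
  · exact min_le_left _ _
  · exact min_le_right _ _

theorem ConvergesAt.add {ρ : Fin 2 → ℝ} (hρ : ∀ s, 0 < ρ s) {f g : MvPowerSeries (Fin 2) ℂ}
    (hf : ConvergesAt ρ f) (hg : ConvergesAt ρ g) : ConvergesAt ρ (f + g) := by
  refine Summable.of_nonneg_of_le
    (fun n => mul_nonneg (norm_nonneg _) (monomialWeight_pos hρ n).le) (fun n => ?_)
    (Summable.add hf hg)
  rw [map_add, ← add_mul]
  exact mul_le_mul_of_nonneg_right (norm_add_le _ _) (monomialWeight_pos hρ n).le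

/-- The weighted `ℓ¹` norm is submultiplicative. -/
theorem ConvergesAt.mul {ρ : Fin 2 → ℝ} (hρ : ∀ s, 0 < ρ s) {f g : MvPowerSeries (Fin 2) ℂ}
    (hf : ConvergesAt ρ f) (hg : ConvergesAt ρ g) :
    ConvergesAt ρ (f * g) ∧ polyNorm ρ (f * g) ≤ polyNorm ρ f * polyNorm ρ g := by
  classical
  let F : (Fin 2 →₀ ℕ) → ℝ := fun n => ‖coeff n f‖ * monomialWeight ρ n
  let G : (Fin 2 →₀ ℕ) → ℝ := fun n => ‖coeff n g‖ * monomialWeight ρ n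
  have hW := fun n => (monomialWeight_pos hρ n).le
  have hF : Summable F := hf
  have hG : Summable G := hg
  have hFG : Summable fun p : (Fin 2 →₀ ℕ) × (Fin 2 →₀ ℕ) => F p.1 * G p.2 :=
    hF.mul_of_nonneg hG (fun n => mul_nonneg (norm_nonneg _) (hW _))
      (fun n => mul_nonneg (norm_nonneg _) (hW _))
  have h : Summable fun n => ∑ p ∈ Finset.HasAntidiagonal.antidiagonal n, F p.1 * G p.2 :=
    summable_sum_mul_antidiagonal_of_summable_mul hFG
  have hle : ∀ n, ‖coeff n (f * g)‖ * monomialWeight ρ n ≤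
      ∑ p ∈ Finset.HasAntidiagonal.antidiagonal n, F p.1 * G p.2 := by
    intro n
    rw [MvPowerSeries.coeff_mul]
    refine (mul_le_mul_of_nonneg_right (norm_sum_le _ _) (hW _)).trans ?_
    rw [Finset.sum_mul]
    refine Finset.sum_le_sum fun p hp => le_of_eq ?_
    rw [← Finset.HasAntidiagonal.mem_antidiagonal.mp hp, monomialWeight_add, norm_mul]
    simp only [F, G]
    ring
  have hs : ConvergesAt ρ (f * g) :=
    Summable.of_nonneg_of_le (fun n => mul_nonneg (norm_nonneg _) (hW _)) hle h
  refine ⟨hs, ?_⟩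
  have := hF.tsum_mul_tsum_eq_tsum_sum_antidiagonal hG hFG
  calc polyNorm ρ (f * g) ≤ ∑' n, ∑ p ∈ Finset.HasAntidiagonal.antidiagonal n, F p.1 * G p.2 :=
        Summable.tsum_le_tsum hle hs h
    _ = polyNorm ρ f * polyNorm ρ g := this.symm

theorem polyNorm_nonneg {ρ : Fin 2 → ℝ} (hρ : ∀ s, 0 < ρ s) (f : MvPowerSeries (Fin 2) ℂ) :
    0 ≤ polyNorm ρ f :=
  tsum_nonneg fun n => mul_nonneg (norm_nonneg _) (monomialWeight_pos hρ n).le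

/-- If the weights of all monomials of `f` shrink by a factor `ε`, so does the norm of `f`. -/
theorem ConvergesAt.shrink {ρ σ : Fin 2 → ℝ} (hρ : ∀ s, 0 < ρ s) {ε : ℝ}
    {f : MvPowerSeries (Fin 2) ℂ} (hf : ConvergesAt σ f)
    (h : ∀ n, coeff n f ≠ 0 → monomialWeight ρ n ≤ ε * monomialWeight σ n) :
    ConvergesAt ρ f ∧ polyNorm ρ f ≤ ε * polyNorm σ f := by
  have hle : ∀ n, ‖coeff n f‖ * monomialWeight ρ n ≤ ε * (‖coeff n f‖ * monomialWeight σ n) := by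
    intro n
    by_cases h0 : coeff n f = 0
    · simp [h0]
    · rw [mul_left_comm]
      exact mul_le_mul_of_nonneg_left (h n h0) (norm_nonneg _)
  have hs : ConvergesAt ρ f :=
    Summable.of_nonneg_of_le (fun n => mul_nonneg (norm_nonneg _) (monomialWeight_pos hρ n).le)
      hle (Summable.mul_left ε hf)
  refine ⟨hs, ?_⟩
  rw [polyNorm, polyNorm, ← tsum_mul_left]
  exact Summable.tsum_le_tsum hle hs (Summable.mul_left ε hf)

/-- A linear operator which halves the weighted `ℓ¹` norm can be inverted in the form
`q - T q = h`, within the series converging on the given polydisc. -/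
theorem exists_eq_add_of_contracting {ρ : Fin 2 → ℝ} (hρ : ∀ s, 0 < ρ s)
    (T : MvPowerSeries (Fin 2) ℂ →ₗ[ℂ] MvPowerSeries (Fin 2) ℂ)
    (hT : ∀ f, ConvergesAt ρ f → ConvergesAt ρ (T f) ∧ polyNorm ρ (T f) ≤ 1 / 2 * polyNorm ρ f)
    {h : MvPowerSeries (Fin 2) ℂ} (hh : ConvergesAt ρ h) :
    ∃ q, ConvergesAt ρ q ∧ q = h + T q := by
  -- Dividing by the weights identifies `ℓ¹` with the series converging on the polydisc.
  let E := lp (fun _ : Fin 2 →₀ ℕ => ℂ) 1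
  have hW := fun n => monomialWeight_pos hρ n
  let w : (Fin 2 →₀ ℕ) → ℂ := fun n => (monomialWeight ρ n : ℂ)
  have hw : ∀ n, w n ≠ 0 := fun n => Complex.ofReal_ne_zero.2 (hW n).ne'
  have hnw : ∀ n, ‖w n‖ = monomialWeight ρ n := fun n => by
    simp [w, abs_of_pos (hW n)]
  let ser : E → MvPowerSeries (Fin 2) ℂ := fun e n => (w n)⁻¹ * e n
  have hcoef : ∀ e n, coeff n (ser e) = (w n)⁻¹ * e n := fun e n => rfl
  have hterm : ∀ e n, ‖coeff n (ser e)‖ * monomialWeight ρ n = ‖e n‖ := by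
    intro e n
    rw [hcoef, norm_mul, norm_inv, hnw]
    field_simp [(hW n).ne']
  have hmem : ∀ f, ConvergesAt ρ f → Memℓp (fun n => w n * coeff n f) 1 := by
    intro f hf
    rw [memℓp_gen_iff (by simp)]
    refine Summable.congr hf fun n => ?_
    simp [hnw, mul_comm]
  have hser : ∀ e, ConvergesAt ρ (ser e) := by
    intro e
    have := (memℓp_gen_iff (by simp)).1 (lp.memℓp e)
    refine Summable.congr this fun n => ?_
    rw [hterm]; simp
  have hnorm : ∀ e, polyNorm ρ (ser e) = ‖e‖ := by
    intro e
    rw [lp.norm_eq_tsum_rpow (by simp), polyNorm]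
    simp [hterm]
  let emb : ∀ f, ConvergesAt ρ f → E := fun f hf => ⟨fun n => w n * coeff n f, hmem f hf⟩
  have hser_emb : ∀ f hf, ser (emb f hf) = f := by
    intro f hf
    ext n
    rw [hcoef]
    change (w n)⁻¹ * (w n * coeff n f) = _
    rw [inv_mul_cancel_left₀ (hw n)]
  have hser_sub : ∀ e e', ser (e - e') = ser e - ser e' := by
    intro e e'
    ext n
    rw [map_sub, hcoef, hcoef, hcoef, ← mul_sub]
    rfl
  have hadd : ∀ e, ConvergesAt ρ (h + T (ser e)) := fun e => hh.add hρ (hT _ (hser e)).1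
  let F : E → E := fun e => emb (h + T (ser e)) (hadd e)
  have hserF : ∀ e, ser (F e) = h + T (ser e) := fun e => hser_emb _ (hadd e)
  have hF : ContractingWith (1 / 2) F := by
    refine ⟨?_, LipschitzWith.of_dist_le_mul fun e e' => ?_⟩
    · rw [← NNReal.coe_lt_coe]; norm_num
    · rw [dist_eq_norm, dist_eq_norm, ← hnorm, ← hnorm, hser_sub, hserF, hserF,
        add_sub_add_left_eq_sub, ← map_sub, ← hser_sub]
      simpa using (hT _ (hser (e - e'))).2
  refine ⟨ser (ContractingWith.fixedPoint F hF), hser _, ?_⟩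
  have := hF.fixedPoint_isFixedPt
  conv_lhs => rw [← this.eq]
  exact hserF _

/-- The equation of the inverse of `1 - w`. -/
theorem exists_eq_one_add_mul {w : MvPowerSeries (Fin 2) ℂ} (hw : IsConvergent w)
    (h0 : coeff 0 w = 0) : ∃ q, IsConvergent q ∧ q = 1 + w * q := by
  obtain ⟨r, hr, hf⟩ := isConvergent_iff_exists_convergesAt_const.1 hw
  set K := polyNorm (fun _ => r) w with hK
  have hK0 : 0 ≤ K := polyNorm_nonneg (fun _ => hr) w
  -- Every monomial of `w` has positive degree, so scaling the polydisc by `ε` makes `w` small.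
  set ε : ℝ := 1 / (2 * (K + 1)) with hε
  have hε0 : 0 < ε := by positivity
  have hε1 : ε ≤ 1 := by rw [hε, div_le_one (by positivity)]; linarith
  have hρ : ∀ s : Fin 2, 0 < (fun _ => ε * r : Fin 2 → ℝ) s := fun _ => by positivity
  obtain ⟨hs, hn⟩ := hf.shrink hρ (ε := ε) (by
    intro n hn
    have hd : n.degree ≠ 0 := by
      intro hd
      rw [Finsupp.degree_eq_zero_iff] at hd
      exact hn (hd ▸ h0)
    rw [monomialWeight_const, monomialWeight_const, mul_pow]
    exact mul_le_mul_of_nonneg_right (pow_le_of_le_one hε0.le hε1 hd) (by positivity))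
  have hhalf : ε * K ≤ 1 / 2 := by
    rw [hε, div_mul_eq_mul_div, div_le_div_iff₀ (by positivity) (by positivity)]; linarith
  obtain ⟨q, hq, hqe⟩ := exists_eq_add_of_contracting hρ (LinearMap.mulLeft ℂ w)
    (fun f hf => ⟨(hs.mul hρ hf).1, ((hs.mul hρ hf).2).trans
      (mul_le_mul_of_nonneg_right (hn.trans hhalf) (polyNorm_nonneg hρ f))⟩)
    (h := 1) (by
      refine summable_of_hasFiniteSupport (Set.Finite.subset (Set.finite_singleton 0) ?_)
      intro n hn
      by_contra h
      apply hn
      classical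
      simp [coeff_one, show n ≠ 0 from h])
  exact ⟨q, hq.isConvergent hρ, hqe⟩

/-- A convergent power series with nonzero constant coefficient is a unit. -/
theorem isUnit_of_coeff_zero_ne_zero {u : ConvSeries}
    (hu : coeff 0 (u : MvPowerSeries (Fin 2) ℂ) ≠ 0) : IsUnit u := by
  set c := coeff 0 (u : MvPowerSeries (Fin 2) ℂ) with hc
  let w : ConvSeries := 1 - c⁻¹ • u
  have hw : coeff 0 (w : MvPowerSeries (Fin 2) ℂ) = 0 := by
    simp only [w, AddSubgroupClass.coe_sub, OneMemClass.coe_one, SetLike.val_smul, map_sub,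
      coeff_zero_one, map_smul, smul_eq_mul, ← hc, inv_mul_cancel₀ hu, sub_self]
  obtain ⟨q, hq, hqe⟩ := exists_eq_one_add_mul w.2 hw
  have h1 : (⟨q, hq⟩ : ConvSeries) = 1 + w * ⟨q, hq⟩ := Subtype.ext hqe
  refine IsUnit.of_mul_eq_one (c⁻¹ • ⟨q, hq⟩) ?_
  have h2 : u * (c⁻¹ • ⟨q, hq⟩) = (c⁻¹ • u) * ⟨q, hq⟩ := by
    rw [mul_smul_comm, smul_mul_assoc]
  have h3 : c⁻¹ • u = 1 - w := by simp [w]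
  rw [h2, h3]
  linear_combination h1

/-- The quotient of `f - f|_{x_i = 0}` by the variable `x_i`. -/
def varQuotient (i : Fin 2) : MvPowerSeries (Fin 2) ℂ →ₗ[ℂ] MvPowerSeries (Fin 2) ℂ where
  toFun f n := coeff (n + single i 1) f
  map_add' f g := by ext n; exact map_add (coeff (n + single i 1)) f g
  map_smul' c f := by ext n; exact map_smul (coeff (n + single i 1)) c f

theorem coeff_varQuotient (i : Fin 2) (f : MvPowerSeries (Fin 2) ℂ) (n : Fin 2 →₀ ℕ) :
    coeff n (varQuotient i f) = coeff (n + single i 1) f := rfl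

theorem varQuotient_X_mul (i : Fin 2) (f : MvPowerSeries (Fin 2) ℂ) :
    varQuotient i (X i * f) = f := by
  ext n
  rw [coeff_varQuotient, add_comm, X_def, coeff_add_monomial_mul, one_mul]

theorem coeff_X_mul_varQuotient (i : Fin 2) (f : MvPowerSeries (Fin 2) ℂ) {n : Fin 2 →₀ ℕ}
    (hn : n i ≠ 0) : coeff n (X i * varQuotient i f) = coeff n f := by
  obtain ⟨m, rfl⟩ : ∃ m, n = single i 1 + m :=
    exists_add_of_le (by rw [Finsupp.single_le_iff]; omega)
  rw [X_def, coeff_add_monomial_mul, one_mul, coeff_varQuotient, add_comm]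

theorem ConvergesAt.varQuotient {ρ : Fin 2 → ℝ} (hρ : ∀ s, 0 < ρ s)
    {f : MvPowerSeries (Fin 2) ℂ} (hf : ConvergesAt ρ f) (i : Fin 2) :
    ConvergesAt ρ (varQuotient i f) ∧
      polyNorm ρ (PlaneCurve.varQuotient i f) ≤ (ρ i)⁻¹ * polyNorm ρ f := by
  have hinj : Function.Injective fun n : Fin 2 →₀ ℕ => n + single i 1 := add_left_injective _
  have heq : ∀ n, ‖coeff n (PlaneCurve.varQuotient i f)‖ * monomialWeight ρ n =
      (ρ i)⁻¹ * (‖coeff (n + single i 1) f‖ * monomialWeight ρ (n + single i 1)) := by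
    intro n
    rw [coeff_varQuotient, monomialWeight_add, monomialWeight_single]
    field_simp [(hρ i).ne']
  have hs : Summable fun n : Fin 2 →₀ ℕ =>
      ‖coeff (n + single i 1) f‖ * monomialWeight ρ (n + single i 1) :=
    Summable.comp_injective hf hinj
  constructor
  · exact (hs.mul_left (ρ i)⁻¹).congr fun n => (heq n).symm
  · rw [polyNorm, tsum_congr heq, tsum_mul_left]
    refine mul_le_mul_of_nonneg_left ?_ (inv_nonneg.2 (hρ i).le)
    exact tsum_comp_le_tsum_of_inj hf
      (fun n => mul_nonneg (norm_nonneg _) (monomialWeight_pos hρ n).le) hinj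

theorem IsConvergent.varQuotient {f : MvPowerSeries (Fin 2) ℂ} (hf : IsConvergent f)
    (i : Fin 2) : IsConvergent (varQuotient i f) := by
  obtain ⟨r, hr, hf⟩ := isConvergent_iff_exists_convergesAt_const.1 hf
  exact ((hf.varQuotient (fun _ => hr) i).1).isConvergent (fun _ => hr)

/-- Weierstrass division by `x_i + w`, where every monomial of `w` involves the other
variable `x_j`. On a polydisc that is thin enough in the direction of `x_j`, multiplication by `w`
is so small that the quotient is the fixed point of a contraction. -/
theorem exists_division_of_var_add {i j : Fin 2} (hij : i ≠ j) {w h : MvPowerSeries (Fin 2) ℂ}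
    (hw : IsConvergent w) (hwj : ∀ n, coeff n w ≠ 0 → n j ≠ 0) (hh : IsConvergent h) :
    ∃ q, IsConvergent q ∧ ∀ n : Fin 2 →₀ ℕ, n i ≠ 0 → coeff n (h - q * (X i + w)) = 0 := by
  obtain ⟨r₁, hr₁, hw⟩ := isConvergent_iff_exists_convergesAt_const.1 hw
  obtain ⟨r₂, hr₂, hh⟩ := isConvergent_iff_exists_convergesAt_const.1 hh
  set r := min r₁ r₂ with hr
  have hr0 : 0 < r := lt_min hr₁ hr₂
  replace hw : ConvergesAt (fun _ => r) w := hw.mono (fun _ => hr0) fun _ => min_le_left _ _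
  replace hh : ConvergesAt (fun _ => r) h := hh.mono (fun _ => hr0) fun _ => min_le_right _ _
  set K := polyNorm (fun _ => r) w with hK
  have hK0 : 0 ≤ K := polyNorm_nonneg (fun _ => hr0) w
  -- With this `ε` the operator `q ↦ (q w - (q w)|_{x_i = 0}) / x_i` has norm at most `1 / 2` on the
  -- polydisc of radius `ε r` in the variable `x_j` and `r` in the variable `x_i`.
  set ε : ℝ := min 1 (r / (2 * (K + 1))) with hε
  have hε0 : 0 < ε := by positivity
  have hε1 : ε ≤ 1 := min_le_left _ _
  have hεr : ε * r ≤ r := mul_le_of_le_one_left hr0.le hε1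
  let ρ : Fin 2 → ℝ := fun s => if s = j then ε * r else r
  have hρ : ∀ s, 0 < ρ s := fun s => by simp only [ρ]; split_ifs <;> positivity
  have hρr : ∀ s, ρ s ≤ r := fun s => by simp only [ρ]; split_ifs <;> linarith
  have hρi : ρ i = r := by simp [ρ, hij]
  obtain ⟨hs, hn⟩ := hw.shrink hρ (ε := ε) (by
    intro n hn
    have hj := hwj n hn
    have hpow : (ε * r) ^ n j ≤ ε * r ^ n j := by
      rw [mul_pow]
      exact mul_le_mul_of_nonneg_right (pow_le_of_le_one hε0.le hε1 hj) (by positivity)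
    clear_value ε r
    fin_cases j
    · simp only [monomialWeight, ρ, Fin.zero_eta, if_true, one_ne_zero, if_false, ← mul_assoc]
      exact mul_le_mul_of_nonneg_right hpow (by positivity)
    · simp only [monomialWeight, ρ, Fin.mk_one, if_true, zero_ne_one, if_false, ← mul_assoc]
      rw [mul_comm (r ^ n 0), mul_right_comm]
      exact mul_le_mul_of_nonneg_right hpow (by positivity))
  have hhalf : r⁻¹ * (ε * K) ≤ 1 / 2 := by
    have h1 : ε * K ≤ r / (2 * (K + 1)) * K := mul_le_mul_of_nonneg_right (min_le_right _ _) hK0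
    have h2 : r⁻¹ * (r / (2 * (K + 1)) * K) = K / (2 * (K + 1)) := by field_simp
    calc r⁻¹ * (ε * K) ≤ r⁻¹ * (r / (2 * (K + 1)) * K) :=
          mul_le_mul_of_nonneg_left h1 (inv_nonneg.2 hr0.le)
      _ = K / (2 * (K + 1)) := h2
      _ ≤ 1 / 2 := by rw [div_le_div_iff₀ (by positivity) (by positivity)]; linarith
  obtain ⟨q, hq, hqe⟩ := exists_eq_add_of_contracting hρ
    (-(varQuotient i).comp (LinearMap.mulRight ℂ w)) (by
      intro f hf
      obtain ⟨h1, h2⟩ := hf.mul hρ hs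
      obtain ⟨h3, h4⟩ := h1.varQuotient hρ i
      have h5 : ∀ g, ConvergesAt ρ g → ConvergesAt ρ (-g) ∧ polyNorm ρ (-g) = polyNorm ρ g := by
        intro g hg
        constructor
        · simpa [ConvergesAt] using hg
        · simp [polyNorm]
      obtain ⟨h6, h7⟩ := h5 _ h3
      refine ⟨h6, ?_⟩
      change polyNorm ρ (-_) ≤ _
      refine (h7.trans_le h4).trans ?_
      rw [hρi]
      calc r⁻¹ * polyNorm ρ (f * w) ≤ r⁻¹ * (polyNorm ρ f * (ε * K)) := by
            refine mul_le_mul_of_nonneg_left (h2.trans ?_) (inv_nonneg.2 hr0.le)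
            exact mul_le_mul_of_nonneg_left hn (polyNorm_nonneg hρ f)
        _ = (r⁻¹ * (ε * K)) * polyNorm ρ f := by ring
        _ ≤ 1 / 2 * polyNorm ρ f := mul_le_mul_of_nonneg_right hhalf (polyNorm_nonneg hρ f))
    ((hh.mono hρ hρr).varQuotient hρ i).1
  refine ⟨q, hq.isConvergent hρ, fun n hn => ?_⟩
  have hzero : varQuotient i (h - q * (X i + w)) = 0 := by
    have : q * (X i + w) = X i * q + q * w := by ring
    rw [this, map_sub, map_add, varQuotient_X_mul]
    change q = varQuotient i h + -(varQuotient i (q * w)) at hqe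
    linear_combination -hqe
  rw [← coeff_X_mul_varQuotient i _ hn, hzero, mul_zero, map_zero]

/-- Weierstrass division in `ℂ{x, y}` by a series of order one in the variable `x_i`:
the remainder does not involve `x_i`. -/
theorem exists_weierstrass_division {i j : Fin 2} (hij : i ≠ j) {g : ConvSeries}
    (h0 : coeff 0 (g : MvPowerSeries (Fin 2) ℂ) = 0)
    (h1 : coeff (single i 1) (g : MvPowerSeries (Fin 2) ℂ) ≠ 0) (h : ConvSeries) :
    ∃ q R : ConvSeries, h = q * g + R ∧
      ∀ n : Fin 2 →₀ ℕ, n i ≠ 0 → coeff n (R : MvPowerSeries (Fin 2) ℂ) = 0 := by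
  -- The unit `v = (g - g|_{x_i = 0}) / x_i` normalizes `g` to the form `x_i + w`.
  let v : ConvSeries := ⟨varQuotient i g.1, g.2.varQuotient i⟩
  have hv : coeff 0 (v : MvPowerSeries (Fin 2) ℂ) ≠ 0 := by
    change coeff 0 (varQuotient i g.1) ≠ 0
    rwa [coeff_varQuotient, zero_add]
  obtain ⟨u, huv⟩ := (isUnit_of_coeff_zero_ne_zero hv).exists_left_inv
  have hXi : IsConvergent (X i) := by
    have := isConvergent_coe (MvPolynomial.X i)
    rwa [MvPolynomial.coe_X] at this
  let xi : ConvSeries := ⟨X i, hXi⟩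
  let g₀ : ConvSeries := g - xi * v
  have hg₀ : ∀ n : Fin 2 →₀ ℕ, coeff n (g₀ : MvPowerSeries (Fin 2) ℂ) ≠ 0 → n j ≠ 0 := by
    intro n hn hj
    apply hn
    change coeff n (g.1 - X i * varQuotient i g.1) = 0
    by_cases hi : n i = 0
    · have : n = 0 := by
        ext s
        by_cases hs : s = i
        · rw [hs]; simpa using hi
        · have : s = j := by omega
          rw [this]; simpa using hj
      rw [this, map_sub, coeff_zero_X_mul, h0, sub_zero]
    · rw [map_sub, coeff_X_mul_varQuotient i _ hi, sub_self]
  have hX : X j ∣ (g₀ : MvPowerSeries (Fin 2) ℂ) := by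
    rw [X_dvd_iff]
    intro m hm
    by_contra h
    exact hg₀ m h hm
  have hw : ∀ n : Fin 2 →₀ ℕ, coeff n ((u * g₀ : ConvSeries) : MvPowerSeries (Fin 2) ℂ) ≠ 0 →
      n j ≠ 0 := by
    intro n hn hj
    exact hn (X_dvd_iff.1 (hX.mul_left (u : MvPowerSeries (Fin 2) ℂ)) n hj)
  obtain ⟨q, hq, hR⟩ := exists_division_of_var_add hij (u * g₀).2 hw h.2
  refine ⟨⟨q, hq⟩ * u, h - ⟨q, hq⟩ * u * g, by ring, fun n hn => ?_⟩
  have hug : u * g = xi + u * g₀ := by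
    simp only [g₀]; linear_combination xi * huv
  have : h - ⟨q, hq⟩ * u * g = h - ⟨q, hq⟩ * (xi + u * g₀) := by
    rw [mul_assoc, hug]
  rw [this]
  exact hR n hn

/-! ### The quotient of the ring of convergent power series by a smooth germ -/

/-- The evaluation of convergent power series at the origin. -/
def evalZero : ConvSeries →+* ℂ :=
  (constantCoeff (σ := Fin 2) (R := ℂ)).comp ConvSeries.val.toRingHom

/-- The coefficients of the linear part of a convergent power series. -/
def linCoeff (i : Fin 2) (f : ConvSeries) : ℂ := coeff (single i 1) (f : MvPowerSeries (Fin 2) ℂ)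

theorem evalZero_apply (f : ConvSeries) :
    evalZero f = coeff 0 (f : MvPowerSeries (Fin 2) ℂ) := rfl

theorem evalZero_algebraMap (c : ℂ) : evalZero (algebraMap ℂ ConvSeries c) = c := by
  change constantCoeff (algebraMap ℂ (MvPowerSeries (Fin 2) ℂ) c) = c
  simp [MvPowerSeries.algebraMap_apply]

theorem linCoeff_eq_evalZero_partialDeriv (i : Fin 2) (f : ConvSeries) :
    linCoeff i f = evalZero (partialDeriv i f) := by
  rw [evalZero_apply, partialDeriv, coeff_pderiv, zero_add]
  simp [linCoeff]

theorem partialDeriv_mul (i : Fin 2) (f g : ConvSeries) :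
    partialDeriv i (f * g) = f * partialDeriv i g + g * partialDeriv i f :=
  Subtype.ext ((MvPowerSeries.pderiv ℂ i).leibniz f.1 g.1)

theorem partialDeriv_add (i : Fin 2) (f g : ConvSeries) :
    partialDeriv i (f + g) = partialDeriv i f + partialDeriv i g :=
  Subtype.ext (map_add (MvPowerSeries.pderiv ℂ i) f.1 g.1)

theorem partialDeriv_sub (i : Fin 2) (f g : ConvSeries) :
    partialDeriv i (f - g) = partialDeriv i f - partialDeriv i g :=
  Subtype.ext (map_sub (MvPowerSeries.pderiv ℂ i) f.1 g.1)

theorem linCoeff_mul (i : Fin 2) (f g : ConvSeries) :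
    linCoeff i (f * g) = evalZero f * linCoeff i g + evalZero g * linCoeff i f := by
  simp only [linCoeff_eq_evalZero_partialDeriv, partialDeriv_mul, map_add, map_mul]

theorem linCoeff_add (i : Fin 2) (f g : ConvSeries) :
    linCoeff i (f + g) = linCoeff i f + linCoeff i g := by
  simp only [linCoeff_eq_evalZero_partialDeriv, partialDeriv_add, map_add]

theorem linCoeff_sub (i : Fin 2) (f g : ConvSeries) :
    linCoeff i (f - g) = linCoeff i f - linCoeff i g := by
  simp only [linCoeff_eq_evalZero_partialDeriv, partialDeriv_sub, map_sub]

theorem isUnit_iff_evalZero_ne_zero {u : ConvSeries} : IsUnit u ↔ evalZero u ≠ 0 :=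
  ⟨fun h => (h.map evalZero).ne_zero, isUnit_of_coeff_zero_ne_zero⟩

theorem isConvergent_X (i : Fin 2) : IsConvergent (X i) := by
  have := isConvergent_coe (MvPolynomial.X i)
  rwa [MvPolynomial.coe_X] at this

/-- The coordinate functions, indexed by `Fin 2`. -/
def var (i : Fin 2) : ConvSeries := ⟨X i, isConvergent_X i⟩

theorem var_zero : var 0 = x := rfl

theorem var_one : var 1 = y := rfl

theorem evalZero_var (i : Fin 2) : evalZero (var i) = 0 :=
  coeff_zero_X i

theorem linCoeff_var (i j : Fin 2) : linCoeff i (var j) = if i = j then 1 else 0 := by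
  rw [linCoeff, var, coeff_X]
  simp [Finsupp.single_left_inj]

/-- The maximal ideal of `ℂ{x, y}`: the series vanishing at the origin. -/
def maxIdeal : Ideal ConvSeries := RingHom.ker evalZero

theorem mem_maxIdeal {f : ConvSeries} : f ∈ maxIdeal ↔ evalZero f = 0 := RingHom.mem_ker

theorem le_maxIdeal {J : Ideal ConvSeries} (hJ : J ≠ ⊤) : J ≤ maxIdeal := by
  intro f hf
  by_contra h
  exact hJ (J.eq_top_of_isUnit_mem hf (isUnit_iff_evalZero_ne_zero.2 h))

/-- Divisibility by a power of a coordinate function is the same for convergent series as for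
formal ones. -/
theorem exists_eq_var_pow_mul (j : Fin 2) (n : ℕ) (f : ConvSeries)
    (h : X j ^ n ∣ (f : MvPowerSeries (Fin 2) ℂ)) : ∃ u : ConvSeries, f = var j ^ n * u := by
  induction n generalizing f with
  | zero => exact ⟨f, by simp⟩
  | succ n ih =>
    obtain ⟨q, hq⟩ := h
    have h1 : varQuotient j f.1 = X j ^ n * q := by
      rw [hq, pow_succ', mul_assoc, varQuotient_X_mul]
    obtain ⟨u, hu⟩ := ih ⟨varQuotient j f.1, f.2.varQuotient j⟩ ⟨q, h1⟩
    refine ⟨u, Subtype.ext ?_⟩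
    have hu' : varQuotient j f.1 = X j ^ n * u.1 := congrArg Subtype.val hu
    change f.1 = X j ^ (n + 1) * u.1
    rw [pow_succ', mul_assoc, ← hu', h1, hq]
    ring

theorem eq_single_of_apply_eq_zero {i j : Fin 2} (hij : i ≠ j) {n : Fin 2 →₀ ℕ} (hn : n i = 0) :
    n = single j (n j) := by
  ext s
  by_cases hs : s = j
  · simp [hs]
  · have : s = i := by omega
    simp [this, hn, hij]

/-- A nonzero series in the variable `x_j` alone is a power of `x_j` times a unit. -/
theorem eq_zero_or_eq_var_pow_mul_isUnit {i j : Fin 2} (hij : i ≠ j) {R : ConvSeries}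
    (hR : ∀ n : Fin 2 →₀ ℕ, n i ≠ 0 → coeff n (R : MvPowerSeries (Fin 2) ℂ) = 0) :
    R = 0 ∨ ∃ (n : ℕ) (u : ConvSeries), IsUnit u ∧ R = var j ^ n * u := by
  classical
  by_cases hex : ∃ n, coeff (single j n) (R : MvPowerSeries (Fin 2) ℂ) ≠ 0
  · right
    have hmin := fun m => Nat.find_min hex (m := m)
    have hspec := Nat.find_spec hex
    generalize Nat.find hex = n at hmin hspec
    obtain ⟨u, hu⟩ := exists_eq_var_pow_mul j n R (by
      rw [X_pow_dvd_iff]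
      intro m hm
      by_cases hi : m i = 0
      · rw [eq_single_of_apply_eq_zero hij hi]
        exact not_not.1 (hmin _ hm)
      · exact hR m hi)
    refine ⟨n, u, isUnit_of_coeff_zero_ne_zero ?_, hu⟩
    rw [hu] at hspec
    change coeff (single j n) (X j ^ n * u.1) ≠ 0 at hspec
    have : coeff (single j n + 0) (X j ^ n * u.1) = 1 * coeff 0 u.1 := by
      rw [X_pow_eq, coeff_add_monomial_mul]
    rw [add_zero, one_mul] at this
    rwa [this] at hspec
  · left
    push Not at hex
    refine Subtype.ext (MvPowerSeries.ext fun n => ?_)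
    by_cases hi : n i = 0
    · rw [eq_single_of_apply_eq_zero hij hi, hex]; simp
    · rw [hR n hi]; simp

/-- A variable of a ring of formal power series over a domain is prime: it generates the kernel of
the substitution of zero for it. -/
theorem X_dvd_mul {j : Fin 2} {f g : MvPowerSeries (Fin 2) ℂ} (h : X j ∣ f * g) :
    X j ∣ f ∨ X j ∣ g := by
  have key : ∀ p : MvPowerSeries (Fin 2) ℂ,
      X j ∣ p ↔ rescale (fun s => if s = j then (0 : ℂ) else 1) p = 0 := by
    intro p
    rw [X_dvd_iff, MvPowerSeries.ext_iff]
    refine forall_congr' fun m => ?_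
    rw [coeff_rescale, map_zero, mul_eq_zero, Finsupp.prod_fintype _ _ (by simp),
      Finset.prod_eq_zero_iff]
    constructor
    · intro hm
      by_cases h0 : m j = 0
      · exact Or.inr (hm h0)
      · exact Or.inl ⟨j, Finset.mem_univ _, by simp [h0]⟩
    · rintro (⟨s, -, hs⟩ | hm) h0
      · by_cases hsj : s = j
        · simp [hsj, h0] at hs
        · simp [hsj] at hs
      · exact hm
  rw [key, map_mul, mul_eq_zero] at h
  rwa [key, key]

/-- `g = 0` is a smooth curve germ through the origin, on which the other coordinate is a local
parameter: `∂g/∂x_i` does not vanish at the origin. -/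
structure IsSmoothAlong (i : Fin 2) (g : ConvSeries) : Prop where
  evalZero_eq : evalZero g = 0
  linCoeff_ne : linCoeff i g ≠ 0

namespace IsSmoothAlong

variable {i j : Fin 2} {g : ConvSeries}

theorem not_isUnit (hg : IsSmoothAlong i g) : ¬ IsUnit g := fun h =>
  isUnit_iff_evalZero_ne_zero.1 h hg.evalZero_eq

/-- The other coordinate is not nilpotent modulo a smooth germ: as `x_j` is prime and does not
divide `g`, a relation `x_j ^ n = q g` could be divided by `x_j` until `g` becomes a unit. -/
theorem not_dvd_var_pow (hg : IsSmoothAlong i g) (hij : i ≠ j) (n : ℕ) : ¬ g ∣ var j ^ n := by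
  induction n with
  | zero => exact fun h => hg.not_isUnit (isUnit_of_dvd_one (by simpa using h))
  | succ n ih =>
    rintro ⟨q, hq⟩
    have hdvd : X j ∣ g.1 * q.1 := ⟨X j ^ n, by
      have := congrArg Subtype.val hq
      change X j ^ (n + 1) = g.1 * q.1 at this
      rw [← this, pow_succ']⟩
    rcases X_dvd_mul hdvd with h | h
    · refine hg.linCoeff_ne (X_dvd_iff.1 h _ ?_)
      simp [hij]
    · obtain ⟨q', hq'⟩ := exists_eq_var_pow_mul j 1 q (by simpa using h)
      refine ih ⟨q', ?_⟩
      have hv : var j ≠ 0 := fun h0 => by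
        simpa [h0, linCoeff] using (linCoeff_var j j)
      refine mul_left_cancel₀ hv ?_
      rw [← pow_succ', hq, hq']
      ring

/-- Modulo a smooth germ, every series is zero or a power of a coordinate times a unit. -/
theorem dvd_or_exists (hg : IsSmoothAlong i g) (hij : i ≠ j) (h : ConvSeries) :
    g ∣ h ∨ ∃ (n : ℕ) (u : ConvSeries), IsUnit u ∧ g ∣ h - var j ^ n * u := by
  obtain ⟨q, R, rfl, hR⟩ := exists_weierstrass_division hij hg.evalZero_eq hg.linCoeff_ne h
  rcases eq_zero_or_eq_var_pow_mul_isUnit hij hR with h0 | ⟨n, u, hu, h0⟩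
  · exact Or.inl ⟨q, by rw [h0]; ring⟩
  · exact Or.inr ⟨n, u, hu, q, by rw [h0]; ring⟩

theorem prime (hg : IsSmoothAlong i g) (hij : i ≠ j) : Prime g := by
  refine ⟨fun h => hg.linCoeff_ne (by simp [h, linCoeff]), hg.not_isUnit, fun a b hab => ?_⟩
  rcases hg.dvd_or_exists hij a with ha | ⟨n, u, hu, ha⟩
  · exact Or.inl ha
  rcases hg.dvd_or_exists hij b with hb | ⟨m, v, hv, hb⟩
  · exact Or.inr hb
  exfalso
  have h1 : g ∣ var j ^ (n + m) * (u * v) := by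
    have := (hab.sub (ha.mul_right b)).sub (hb.mul_left (var j ^ n * u))
    ring_nf at this ⊢
    exact this
  rw [(hu.mul hv).dvd_mul_right] at h1
  exact hg.not_dvd_var_pow hij _ h1

/-- Any two series are comparable for divisibility modulo a smooth germ. -/
theorem dvd_sub_mul_total (hg : IsSmoothAlong i g) (hij : i ≠ j) (a b : ConvSeries) :
    ∃ h, g ∣ a - h * b ∨ g ∣ b - h * a := by
  rcases hg.dvd_or_exists hij a with ha | ⟨n, u, hu, ha⟩
  · exact ⟨0, Or.inl (by simpa using ha)⟩
  rcases hg.dvd_or_exists hij b with hb | ⟨m, v, hv, hb⟩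
  · exact ⟨0, Or.inr (by simpa using hb)⟩
  wlog hnm : n ≤ m generalizing a b n m u v
  · obtain ⟨h, hh⟩ := this b a m v hv hb n u hu ha (by omega)
    exact ⟨h, hh.symm⟩
  obtain ⟨u', hu'⟩ := hu.exists_right_inv
  obtain ⟨l, rfl⟩ := Nat.exists_eq_add_of_le hnm
  refine ⟨var j ^ l * v * u', Or.inr ?_⟩
  have : b - var j ^ l * v * u' * a = (b - var j ^ (n + l) * v) -
      (a - var j ^ n * u) * (var j ^ l * v * u') := by
    rw [pow_add]
    linear_combination (-(var j ^ n * var j ^ l * v)) * hu'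
  rw [this]
  exact hb.sub (ha.mul_right _)

/-- The quotient by a smooth germ has dimension one: a strictly larger prime contains a power of
the parameter `x_j`. -/
theorem eq_span_or_eq_maxIdeal (hg : IsSmoothAlong i g) (hij : i ≠ j) {P : Ideal ConvSeries}
    (hP : P.IsPrime) (hgP : g ∈ P) : P = Ideal.span {g} ∨ P = maxIdeal := by
  by_cases hle : P ≤ Ideal.span {g}
  · exact Or.inl (le_antisymm hle ((Ideal.span_singleton_le_iff_mem _).2 hgP))
  right
  refine le_antisymm (le_maxIdeal hP.ne_top) fun h hh => ?_
  obtain ⟨p, hp, hpg⟩ := SetLike.not_le_iff_exists.1 hle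
  rw [Ideal.mem_span_singleton] at hpg
  obtain ⟨n, u, hu, q, hq⟩ := (hg.dvd_or_exists hij p).resolve_left hpg
  have hv : var j ∈ P := by
    have h1 : var j ^ n * u ∈ P := by
      have : var j ^ n * u = p - g * q := by rw [← hq]; ring
      rw [this]
      exact P.sub_mem hp (P.mul_mem_right _ hgP)
    exact hP.mem_of_pow_mem n (((Ideal.unit_mul_mem_iff_mem P hu).1 (by rwa [mul_comm] at h1)))
  rcases hg.dvd_or_exists hij h with ⟨q, hq⟩ | ⟨m, v, hv', q, hq⟩
  · rw [hq]; exact P.mul_mem_right _ hgP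
  · have hm : m ≠ 0 := by
      rintro rfl
      have := congrArg evalZero hq
      rw [map_sub, map_mul, map_mul, mem_maxIdeal.1 hh, hg.evalZero_eq] at this
      simp only [pow_zero, map_one, one_mul, zero_mul, zero_sub, neg_eq_zero] at this
      exact isUnit_iff_evalZero_ne_zero.1 hv' this
    have : h = g * q + var j ^ m * v := by rw [← hq]; ring
    rw [this]
    exact P.add_mem (P.mul_mem_right _ hgP)
      (P.mul_mem_right _ (P.pow_mem_of_mem hv m (Nat.pos_of_ne_zero hm)))

end IsSmoothAlong

/-! ### Intersection numbers of smooth germs -/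

namespace IsSmoothAlong

variable {i j : Fin 2} {g : ConvSeries}

/-- The classes of `1, x_j, …, x_j ^ (n - 1)` form a basis modulo `g` and `x_j ^ n`. -/
theorem finrank_quotient (hg : IsSmoothAlong i g) (hij : i ≠ j) (n : ℕ) :
    intersectionMultiplicity (Ideal.span {g}) (Ideal.span {var j ^ n}) = n := by
  set J := Ideal.span {g} ⊔ Ideal.span {var j ^ n} with hJ
  have hmem : ∀ f, f ∈ J ↔ ∃ a, g ∣ f - a * var j ^ n := by
    intro f
    rw [hJ, Submodule.mem_sup]
    simp only [Ideal.mem_span_singleton']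
    constructor
    · rintro ⟨_, ⟨a, rfl⟩, _, ⟨b, rfl⟩, rfl⟩
      exact ⟨b, a, by ring⟩
    · rintro ⟨b, a, h⟩
      exact ⟨_, ⟨a, rfl⟩, _, ⟨b, rfl⟩, by linear_combination -h⟩
  let φ : (Fin n → ℂ) →ₗ[ℂ] (ConvSeries ⧸ J) :=
    (Ideal.Quotient.mkₐ ℂ J).toLinearMap.comp
      (Fintype.linearCombination ℂ fun l : Fin n => var j ^ (l : ℕ))
  have hφ : ∀ c, φ c = Ideal.Quotient.mk J (∑ l : Fin n, c l • var j ^ (l : ℕ)) := fun c => rfl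
  have hcoeff : ∀ (c : Fin n → ℂ) (m : Fin 2 →₀ ℕ),
      coeff m ((∑ l : Fin n, c l • var j ^ (l : ℕ) : ConvSeries) : MvPowerSeries (Fin 2) ℂ) =
        ∑ l : Fin n, if m = single j (l : ℕ) then c l else 0 := by
    intro c m
    rw [AddSubmonoidClass.coe_finsetSum, map_sum]
    refine Finset.sum_congr rfl fun l _ => ?_
    change coeff m (c l • (X j : MvPowerSeries (Fin 2) ℂ) ^ (l : ℕ)) = _
    rw [map_smul, coeff_X_pow]
    simp
  have hinj : Function.Injective φ := by
    rw [← LinearMap.ker_eq_bot, LinearMap.ker_eq_bot']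
    intro c hc
    rw [hφ, Ideal.Quotient.eq_zero_iff_mem, hmem] at hc
    obtain ⟨a, ha⟩ := hc
    have hR : ∀ m : Fin 2 →₀ ℕ, m i ≠ 0 →
        coeff m ((∑ l : Fin n, c l • var j ^ (l : ℕ) : ConvSeries) :
          MvPowerSeries (Fin 2) ℂ) = 0 := by
      intro m hm
      rw [hcoeff]
      refine Finset.sum_eq_zero fun l _ => if_neg ?_
      rintro rfl
      simp [hij] at hm
    have hc' : ∀ l : Fin n, coeff (single j (l : ℕ))
        ((∑ l : Fin n, c l • var j ^ (l : ℕ) : ConvSeries) : MvPowerSeries (Fin 2) ℂ) = c l := by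
      intro l
      rw [hcoeff, Finset.sum_eq_single l]
      · simp
      · intro l' _ hl'
        rw [if_neg]
        intro h
        exact hl' (Fin.ext (Finsupp.single_injective j h).symm)
      · simp
    rcases eq_zero_or_eq_var_pow_mul_isUnit hij hR with h0 | ⟨m, u, hu, h0⟩
    · ext l
      rw [← hc' l, h0]; simp
    exfalso
    by_cases hmn : n ≤ m
    · have : coeff (single j m) ((∑ l : Fin n, c l • var j ^ (l : ℕ) : ConvSeries) :
          MvPowerSeries (Fin 2) ℂ) = 0 := by
        rw [hcoeff]
        refine Finset.sum_eq_zero fun l _ => if_neg fun h => ?_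
        have := Finsupp.single_injective j h
        omega
      rw [h0] at this
      change coeff (single j m) (X j ^ m * u.1) = 0 at this
      have h1 : coeff (single j m + 0) (X j ^ m * u.1) = 1 * coeff 0 u.1 := by
        rw [X_pow_eq, coeff_add_monomial_mul]
      rw [add_zero, this, one_mul] at h1
      exact isUnit_iff_evalZero_ne_zero.1 hu h1.symm
    · obtain ⟨l, rfl⟩ := Nat.exists_eq_add_of_lt (not_le.1 hmn)
      rw [h0] at ha
      have hu' : IsUnit (u - a * var j ^ (l + 1)) := by
        rw [isUnit_iff_evalZero_ne_zero, map_sub, map_mul, map_pow, evalZero_var,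
          zero_pow (by omega), mul_zero, sub_zero]
        exact isUnit_iff_evalZero_ne_zero.1 hu
      have : var j ^ m * u - a * var j ^ (m + l + 1) =
          var j ^ m * (u - a * var j ^ (l + 1)) := by ring
      rw [this, hu'.dvd_mul_right] at ha
      exact hg.not_dvd_var_pow hij _ ha
  have hsurj : Function.Surjective φ := by
    intro q
    obtain ⟨f, rfl⟩ := Ideal.Quotient.mk_surjective q
    obtain ⟨q, R, rfl, hR⟩ := exists_weierstrass_division hij hg.evalZero_eq hg.linCoeff_ne f
    refine ⟨fun l => coeff (single j (l : ℕ)) (R : MvPowerSeries (Fin 2) ℂ), ?_⟩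
    rw [hφ, Ideal.Quotient.eq, hmem]
    set p : ConvSeries := ∑ l : Fin n, coeff (single j (l : ℕ)) (R : MvPowerSeries (Fin 2) ℂ) •
      var j ^ (l : ℕ) with hp
    obtain ⟨a, ha⟩ := exists_eq_var_pow_mul j n (p - R) (by
      rw [X_pow_dvd_iff]
      intro m hm
      change coeff m (p.1 - R.1) = 0
      rw [map_sub, hp, hcoeff]
      by_cases hi : m i = 0
      · have hms := eq_single_of_apply_eq_zero hij hi
        rw [Finset.sum_eq_single ⟨m j, hm⟩]
        · rw [if_pos hms, ← hms, sub_self]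
        · intro l _ hl
          rw [if_neg]
          intro h
          apply hl
          exact Fin.ext (by simpa using (DFunLike.congr_fun h j).symm)
        · simp
      · rw [hR m hi, sub_zero]
        refine Finset.sum_eq_zero fun l _ => if_neg ?_
        rintro rfl
        simp [hij] at hi)
    exact ⟨a, -q, by linear_combination ha⟩
  rw [intersectionMultiplicity, ← (LinearEquiv.ofBijective φ ⟨hinj, hsurj⟩).finrank_eq,
    Module.finrank_fin_fun]

theorem valueSemigroup_eq (hg : IsSmoothAlong i g) (hij : i ≠ j) :
    valueSemigroup (Ideal.span {g}) = Set.univ := by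
  refine Set.eq_univ_of_forall fun n => ⟨var j ^ n, ?_, hg.finrank_quotient hij n⟩
  rw [Ideal.mem_span_singleton]
  exact hg.not_dvd_var_pow hij n

theorem sup_span_var (hg : IsSmoothAlong i g) (hij : i ≠ j) :
    Ideal.span {g} ⊔ Ideal.span {var j} = maxIdeal := by
  refine le_antisymm (sup_le ?_ ?_) fun h hh => ?_
  · rw [Ideal.span_singleton_le_iff_mem, mem_maxIdeal, hg.evalZero_eq]
  · rw [Ideal.span_singleton_le_iff_mem, mem_maxIdeal, evalZero_var]
  obtain ⟨q, R, rfl, hR⟩ := exists_weierstrass_division hij hg.evalZero_eq hg.linCoeff_ne h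
  refine Submodule.add_mem_sup (Ideal.mem_span_singleton'.2 ⟨q, rfl⟩) ?_
  rw [mem_maxIdeal, map_add, map_mul, hg.evalZero_eq, mul_zero, zero_add] at hh
  obtain ⟨a, ha⟩ := exists_eq_var_pow_mul j 1 R (by
    rw [pow_one, X_dvd_iff]
    intro m hm
    by_cases hi : m i = 0
    · rw [eq_single_of_apply_eq_zero hij hi, hm, Finsupp.single_zero]
      exact hh
    · exact hR m hi)
  exact Ideal.mem_span_singleton.2 ⟨a, by rw [ha, pow_one]⟩

end IsSmoothAlong

/-- A smooth curve germ through the origin: the equation vanishes there and its differential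
does not. -/
def IsSmooth (g : ConvSeries) : Prop := ∃ i, IsSmoothAlong i g

/-- Two smooth germs are transversal: their differentials at the origin are independent. -/
def Transversal (g h : ConvSeries) : Prop :=
  linCoeff 0 g * linCoeff 1 h - linCoeff 1 g * linCoeff 0 h ≠ 0

theorem isSmooth_iff {g : ConvSeries} :
    IsSmooth g ↔ evalZero g = 0 ∧ (linCoeff 0 g ≠ 0 ∨ linCoeff 1 g ≠ 0) := by
  constructor
  · rintro ⟨i, h0, h1⟩
    refine ⟨h0, ?_⟩
    fin_cases i
    · exact Or.inl h1
    · exact Or.inr h1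
  · rintro ⟨h0, h1 | h1⟩
    · exact ⟨0, h0, h1⟩
    · exact ⟨1, h0, h1⟩

theorem exists_index_ne (i : Fin 2) : ∃ j, i ≠ j := by
  fin_cases i
  · exact ⟨1, by simp⟩
  · exact ⟨0, by simp⟩

theorem IsSmooth.prime {g : ConvSeries} (hg : IsSmooth g) : Prime g := by
  obtain ⟨i, hg⟩ := hg
  obtain ⟨j, hij⟩ := exists_index_ne i
  exact hg.prime hij

theorem IsSmooth.evalZero_eq {g : ConvSeries} (hg : IsSmooth g) : evalZero g = 0 :=
  (isSmooth_iff.1 hg).1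

theorem IsSmooth.valueSemigroup_eq {g : ConvSeries} (hg : IsSmooth g) :
    valueSemigroup (Ideal.span {g}) = Set.univ := by
  obtain ⟨i, hg⟩ := hg
  obtain ⟨j, hij⟩ := exists_index_ne i
  exact hg.valueSemigroup_eq hij

theorem IsSmooth.dvd_sub_mul_total {g : ConvSeries} (hg : IsSmooth g) (a b : ConvSeries) :
    ∃ h, g ∣ a - h * b ∨ g ∣ b - h * a := by
  obtain ⟨i, hg⟩ := hg
  obtain ⟨j, hij⟩ := exists_index_ne i
  exact hg.dvd_sub_mul_total hij a b

theorem IsSmooth.eq_span_or_eq_maxIdeal {g : ConvSeries} (hg : IsSmooth g)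
    {P : Ideal ConvSeries} (hP : P.IsPrime) (hgP : g ∈ P) :
    P = Ideal.span {g} ∨ P = maxIdeal := by
  obtain ⟨i, hg⟩ := hg
  obtain ⟨j, hij⟩ := exists_index_ne i
  exact hg.eq_span_or_eq_maxIdeal hij hP hgP

/-- Two smooth transversal germs generate the maximal ideal: the remainder of one modulo the
other is a coordinate times a unit. -/
theorem Transversal.sup_eq_maxIdeal {g h : ConvSeries} (hgh : Transversal g h) (hg : IsSmooth g)
    (hh : IsSmooth h) : Ideal.span {g} ⊔ Ideal.span {h} = maxIdeal := by
  refine le_antisymm (sup_le ?_ ?_) ?_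
  · rw [Ideal.span_singleton_le_iff_mem, mem_maxIdeal, hg.evalZero_eq]
  · rw [Ideal.span_singleton_le_iff_mem, mem_maxIdeal, hh.evalZero_eq]
  obtain ⟨i, hg⟩ := hg
  obtain ⟨j, hij⟩ := exists_index_ne i
  rw [← hg.sup_span_var hij]
  refine sup_le le_sup_left ?_
  rw [Ideal.span_singleton_le_iff_mem]
  obtain ⟨n, u, hu, q, hq⟩ := (hg.dvd_or_exists hij h).resolve_left (by
    rintro ⟨q, rfl⟩
    apply hgh
    simp only [linCoeff_mul, hg.evalZero_eq]
    ring)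
  have hh' : h = g * q + var j ^ n * u := by rw [← hq]; ring
  have hn : n = 1 := by
    match n, hh' with
    | 0, hh' =>
      have := congrArg evalZero hh'
      rw [map_add, map_mul, hh.evalZero_eq, hg.evalZero_eq] at this
      simp only [zero_mul, pow_zero, one_mul, zero_add] at this
      exact (isUnit_iff_evalZero_ne_zero.1 hu this.symm).elim
    | 1, _ => rfl
    | n + 2, hh' =>
      exfalso
      apply hgh
      have h2 : h = g * q + var j * (var j * (var j ^ n * u)) := by rw [hh']; ring
      rw [h2]
      simp only [linCoeff_add, linCoeff_mul, hg.evalZero_eq, evalZero_var, map_mul]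
      ring
  rw [hn, pow_one] at hh'
  obtain ⟨u', hu'⟩ := hu.exists_right_inv
  have : var j = (-q * u') * g + u' * h := by
    rw [hh']; linear_combination (-(var j)) * hu'
  rw [this]
  exact Submodule.add_mem_sup (Ideal.mem_span_singleton'.2 ⟨_, rfl⟩)
    (Ideal.mem_span_singleton'.2 ⟨_, rfl⟩)

theorem finrank_quotient_maxIdeal : Module.finrank ℂ (ConvSeries ⧸ maxIdeal) = 1 := by
  have hx : IsSmoothAlong 0 (var 0) := ⟨evalZero_var 0, by simp [linCoeff_var]⟩
  have := hx.finrank_quotient (j := 1) (by simp) 1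
  rwa [intersectionMultiplicity, pow_one, hx.sup_span_var (by simp)] at this

/-- A point with multiplicity one is reduced: the quotient consists of constants. -/
theorem eq_maxIdeal_of_finrank_eq_one {J : Ideal ConvSeries}
    (hJ : Module.finrank ℂ (ConvSeries ⧸ J) = 1) : J = maxIdeal := by
  have hne : J ≠ ⊤ := by
    rintro rfl
    rw [Module.finrank_zero_of_subsingleton] at hJ
    exact zero_ne_one hJ
  refine le_antisymm (le_maxIdeal hne) fun h hh => ?_
  have h1 : (1 : ConvSeries ⧸ J) ≠ 0 := fun h0 =>
    hne ((Ideal.eq_top_iff_one J).2 (Ideal.Quotient.eq_zero_iff_mem.1 h0))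
  obtain ⟨c, hc⟩ := (finrank_eq_one_iff_of_nonzero' (1 : ConvSeries ⧸ J) h1).1 hJ
    (Ideal.Quotient.mk J h)
  have hmem : algebraMap ℂ ConvSeries c - h ∈ J := by
    rw [← Ideal.Quotient.eq, ← hc]
    exact Algebra.algebraMap_eq_smul_one (A := ConvSeries ⧸ J) c
  have hc0 : c = 0 := by
    have := mem_maxIdeal.1 (le_maxIdeal hne hmem)
    rw [map_sub, mem_maxIdeal.1 hh, sub_zero] at this
    rwa [evalZero_algebraMap] at this
  rw [hc0, map_zero, zero_sub] at hmem
  exact J.neg_mem_iff.1 hmem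

theorem Transversal.intersectionMultiplicity_eq {g h : ConvSeries} (hgh : Transversal g h)
    (hg : IsSmooth g) (hh : IsSmooth h) :
    intersectionMultiplicity (Ideal.span {g}) (Ideal.span {h}) = 1 := by
  rw [intersectionMultiplicity, hgh.sup_eq_maxIdeal hg hh, finrank_quotient_maxIdeal]

/-- If `P` together with one more element generates the maximal ideal, then `P` contains an element
with nonzero linear part, as the maximal ideal has independent linear parts. -/
theorem exists_isSmooth_mem {P : Ideal ConvSeries} {h : ConvSeries}
    (hP : P ⊔ Ideal.span {h} = maxIdeal) : ∃ g ∈ P, IsSmooth g := by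
  have hle : ∀ p ∈ P, evalZero p = 0 := fun p hp =>
    mem_maxIdeal.1 (hP ▸ (le_sup_left : P ≤ P ⊔ Ideal.span {h}) hp)
  have hh0 : evalZero h = 0 :=
    mem_maxIdeal.1 (hP ▸ (le_sup_right : _ ≤ P ⊔ Ideal.span {h}) (Ideal.mem_span_singleton_self h))
  by_contra! hcon
  have hlin : ∀ p ∈ P, ∀ i, linCoeff i p = 0 := by
    intro p hp i
    by_contra hi
    exact hcon p hp ⟨i, hle p hp, hi⟩
  have key : ∀ f ∈ maxIdeal, ∃ c, ∀ i, linCoeff i f = c * linCoeff i h := by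
    intro f hf
    rw [← hP] at hf
    obtain ⟨p, hp, q, hq, rfl⟩ := Submodule.mem_sup.1 hf
    obtain ⟨a, rfl⟩ := Ideal.mem_span_singleton'.1 hq
    refine ⟨evalZero a, fun i => ?_⟩
    rw [linCoeff_add, linCoeff_mul, hlin p hp, hh0]
    ring
  obtain ⟨c, hc⟩ := key (var 0) (mem_maxIdeal.2 (evalZero_var 0))
  obtain ⟨d, hd⟩ := key (var 1) (mem_maxIdeal.2 (evalZero_var 1))
  have h1 := hc 0
  have h2 := hc 1
  have h3 := hd 0
  have h4 := hd 1
  simp only [linCoeff_var, if_true, zero_ne_one, one_ne_zero, if_false] at h1 h2 h3 h4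
  have : (1 : ℂ) = 0 := by
    calc (1 : ℂ) = (c * linCoeff 0 h) * (d * linCoeff 1 h) := by rw [← h1, ← h4, one_mul]
      _ = (c * linCoeff 1 h) * (d * linCoeff 0 h) := by ring
      _ = 0 := by rw [← h2, zero_mul]
  exact one_ne_zero this

/-- Germs generating the maximal ideal have independent linear parts. -/
theorem transversal_of_sup_eq_maxIdeal {g h : ConvSeries} (hg : evalZero g = 0)
    (hh : evalZero h = 0) (hgh : Ideal.span {g} ⊔ Ideal.span {h} = maxIdeal) :
    Transversal g h := by
  have key : ∀ f ∈ maxIdeal, ∃ a b, ∀ i, linCoeff i f = a * linCoeff i g + b * linCoeff i h := by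
    intro f hf
    rw [← hgh] at hf
    obtain ⟨p, hp, q, hq, rfl⟩ := Submodule.mem_sup.1 hf
    obtain ⟨a, rfl⟩ := Ideal.mem_span_singleton'.1 hp
    obtain ⟨b, rfl⟩ := Ideal.mem_span_singleton'.1 hq
    refine ⟨evalZero a, evalZero b, fun i => ?_⟩
    rw [linCoeff_add, linCoeff_mul, linCoeff_mul, hh, hg]
    ring
  obtain ⟨a, b, hab⟩ := key (var 0) (mem_maxIdeal.2 (evalZero_var 0))
  obtain ⟨c, d, hcd⟩ := key (var 1) (mem_maxIdeal.2 (evalZero_var 1))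
  have h1 := hab 0
  have h2 := hab 1
  have h3 := hcd 0
  have h4 := hcd 1
  simp only [linCoeff_var, if_true, zero_ne_one, one_ne_zero, if_false] at h1 h2 h3 h4
  intro h0
  have : (1 : ℂ) = (a * d - b * c) *
      (linCoeff 0 g * linCoeff 1 h - linCoeff 1 g * linCoeff 0 h) := by
    linear_combination (c * linCoeff 1 g + d * linCoeff 1 h) * h1 + h4 -
      (c * linCoeff 0 g + d * linCoeff 0 h) * h2
  rw [h0, mul_zero] at this
  exact one_ne_zero this

/-! ### Unions of transversal smooth germs -/

/-- A family of smooth, pairwise transversal germs of plane curves. -/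
structure IsTransversalFamily {ι : Type*} (g : ι → ConvSeries) : Prop where
  isSmooth : ∀ i, IsSmooth (g i)
  transversal : ∀ i j, i ≠ j → Transversal (g i) (g j)

namespace IsTransversalFamily

variable {ι : Type*} {g : ι → ConvSeries}

theorem not_dvd (hg : IsTransversalFamily g) {i j : ι} (hij : i ≠ j) : ¬ g i ∣ g j := by
  rintro ⟨q, hq⟩
  apply hg.transversal i j hij
  rw [hq]
  simp only [linCoeff_mul, (hg.isSmooth i).evalZero_eq]
  ring

theorem eq_of_span_le (hg : IsTransversalFamily g) {i j : ι}
    (h : Ideal.span {g j} ≤ Ideal.span {g i}) : i = j := by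
  by_contra hij
  rw [Ideal.span_singleton_le_span_singleton] at h
  exact hg.not_dvd hij h

theorem dvd_of_dvd_prod (hg : IsTransversalFamily g) {s : Finset ι} {i : ι}
    (h : g i ∣ ∏ j ∈ s, g j) : i ∈ s := by
  obtain ⟨j, hj, hij⟩ := (hg.isSmooth i).prime.exists_mem_finset_dvd h
  by_contra his
  exact hg.not_dvd (fun h => his (by rwa [h])) hij

theorem prod_dvd (hg : IsTransversalFamily g) (s : Finset ι) {f : ConvSeries}
    (h : ∀ i ∈ s, g i ∣ f) : ∏ i ∈ s, g i ∣ f := by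
  classical
  induction s using Finset.induction_on with
  | empty => simp
  | insert i s hi ih =>
    rw [Finset.prod_insert hi]
    obtain ⟨q, rfl⟩ := ih fun j hj => h j (Finset.mem_insert_of_mem hj)
    rcases (hg.isSmooth i).prime.dvd_or_dvd (h i (Finset.mem_insert_self i s)) with h1 | h1
    · exact (hi (hg.dvd_of_dvd_prod h1)).elim
    · rw [mul_comm]
      exact mul_dvd_mul_left _ h1

variable [Fintype ι]

theorem isReducedEquation [Nonempty ι] (hg : IsTransversalFamily g) :
    IsReducedEquation (∏ i, g i) where
  ne_zero := Finset.prod_ne_zero_iff.2 fun i _ => (hg.isSmooth i).prime.ne_zero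
  not_isUnit h := by
    obtain ⟨i⟩ := ‹Nonempty ι›
    exact (hg.isSmooth i).prime.not_isUnit
      (isUnit_of_dvd_unit (Finset.dvd_prod_of_mem g (Finset.mem_univ i)) h)
  isRadical := by
    rintro f ⟨n, hn⟩
    rw [Ideal.mem_span_singleton] at hn ⊢
    exact hg.prod_dvd _ fun i hi => (hg.isSmooth i).prime.dvd_of_dvd_pow
      ((Finset.dvd_prod_of_mem g hi).trans hn)

theorem span_mem_minimalPrimes (hg : IsTransversalFamily g) (i : ι) :
    Ideal.span {g i} ∈ (Ideal.span {∏ i, g i}).minimalPrimes := by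
  have hprime := fun i => (Ideal.span_singleton_prime (hg.isSmooth i).prime.ne_zero).2
    (hg.isSmooth i).prime
  refine ⟨⟨hprime i, ?_⟩, ?_⟩
  · rw [Ideal.span_singleton_le_span_singleton]
    exact Finset.dvd_prod_of_mem g (Finset.mem_univ i)
  · rintro P ⟨hP, hle⟩ hPi
    rw [Ideal.span_singleton_le_iff_mem, hP.prod_mem_iff] at hle
    obtain ⟨j, -, hj⟩ := hle
    rw [← Ideal.span_singleton_le_iff_mem] at hj
    obtain rfl := hg.eq_of_span_le (hj.trans hPi)
    exact hj

/-- The branches of a union of smooth transversal germs are these germs. -/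
def branchEquiv (hg : IsTransversalFamily g) : ι ≃ Branch (∏ i, g i) :=
  Equiv.ofBijective (fun i => ⟨Ideal.span {g i}, hg.span_mem_minimalPrimes i⟩) <| by
    constructor
    · intro i j hij
      exact hg.eq_of_span_le (Subtype.ext_iff.1 hij).ge
    · rintro ⟨P, hP⟩
      have hle := hP.1.2
      rw [Ideal.span_singleton_le_iff_mem, hP.1.1.prod_mem_iff] at hle
      obtain ⟨j, -, hj⟩ := hle
      rw [← Ideal.span_singleton_le_iff_mem] at hj
      exact ⟨j, Subtype.ext (le_antisymm hj (hP.2 (hg.span_mem_minimalPrimes j).1 hj))⟩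

theorem valueSemigroup_branch (hg : IsTransversalFamily g) (P : Branch (∏ i, g i)) :
    valueSemigroup P.1 = Set.univ := by
  obtain ⟨i, rfl⟩ := hg.branchEquiv.surjective P
  exact (hg.isSmooth i).valueSemigroup_eq

theorem intersectionMultiplicity_branch (hg : IsTransversalFamily g)
    {P Q : Branch (∏ i, g i)} (hPQ : P ≠ Q) : intersectionMultiplicity P.1 Q.1 = 1 := by
  obtain ⟨i, rfl⟩ := hg.branchEquiv.surjective P
  obtain ⟨j, rfl⟩ := hg.branchEquiv.surjective Q
  exact (hg.transversal i j fun h => hPQ (h ▸ rfl)).intersectionMultiplicity_eq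
    (hg.isSmooth i) (hg.isSmooth j)

theorem equisingular {κ : Type*} [Fintype κ] {h : κ → ConvSeries} (hg : IsTransversalFamily g)
    (hh : IsTransversalFamily h) (e : ι ≃ κ) : Equisingular (∏ i, g i) (∏ i, h i) := by
  refine ⟨(hg.branchEquiv.symm.trans e).trans hh.branchEquiv, fun P => ?_, fun P Q hPQ => ?_⟩
  · rw [hg.valueSemigroup_branch, hh.valueSemigroup_branch]
  · rw [hg.intersectionMultiplicity_branch hPQ, hh.intersectionMultiplicity_branch]
    simpa using hPQ

end IsTransversalFamily

theorem partialDeriv_algebraMap (i : Fin 2) (c : ℂ) :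
    partialDeriv i (algebraMap ℂ ConvSeries c) = 0 :=
  Subtype.ext ((MvPowerSeries.pderiv ℂ i).map_algebraMap c)

theorem linCoeff_algebraMap (i : Fin 2) (c : ℂ) : linCoeff i (algebraMap ℂ ConvSeries c) = 0 := by
  rw [linCoeff_eq_evalZero_partialDeriv, partialDeriv_algebraMap, map_zero]

instance : IsDomain ConvSeries := NoZeroDivisors.to_isDomain _

/-- The curve `y ^ N - x ^ N` is the union of the `N` lines `y = ζ x`, `ζ ^ N = 1`. -/
theorem exists_linesEquation_eq_prod {N : ℕ} (hN : 0 < N) :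
    ∃ g : Fin N → ConvSeries, IsTransversalFamily g ∧ linesEquation N = ∏ i, g i := by
  have : NeZero N := ⟨hN.ne'⟩
  have hζ := Complex.isPrimitiveRoot_exp N hN.ne'
  set ζ := Complex.exp (2 * Real.pi * Complex.I / N)
  have hinj : Function.Injective (algebraMap ℂ ConvSeries) := (algebraMap ℂ ConvSeries).injective
  have hζ' : IsPrimitiveRoot (algebraMap ℂ ConvSeries ζ) N := hζ.map_of_injective hinj
  refine ⟨fun i => y - algebraMap ℂ ConvSeries (ζ ^ (i : ℕ)) * x, ⟨fun i => ?_, fun i j hij => ?_⟩,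
    ?_⟩
  · refine isSmooth_iff.2 ⟨?_, Or.inr ?_⟩
    · simp [← var_zero, ← var_one, evalZero_var]
    · simp [linCoeff_sub, linCoeff_mul, ← var_zero, ← var_one, evalZero_var, linCoeff_var]
  · simp only [Transversal, linCoeff_sub, linCoeff_mul, ← var_zero, ← var_one, evalZero_var,
      linCoeff_var, linCoeff_algebraMap, evalZero_algebraMap]
    simp only [if_true, zero_ne_one, one_ne_zero, if_false]
    have := fun h => hij (Fin.ext (hζ.pow_inj i.2 j.2 h))
    intro h
    exact this (by linear_combination -h)
  · rw [linesEquation, hζ'.pow_sub_pow_eq_prod_sub_mul _ _ hN]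
    symm
    refine Finset.prod_bij (fun i _ => algebraMap ℂ ConvSeries (ζ ^ (i : ℕ))) ?_ ?_ ?_ ?_
    · intro i _
      rw [Polynomial.mem_nthRootsFinset hN, ← map_pow, ← pow_mul, mul_comm, pow_mul, hζ.pow_eq_one,
        one_pow, map_one]
    · intro i _ j _ h
      exact Fin.ext (hζ.pow_inj i.2 j.2 (hinj h))
    · intro b hb
      rw [Polynomial.mem_nthRootsFinset hN] at hb
      obtain ⟨i, hi, rfl⟩ := hζ'.eq_pow_of_pow_eq_one hb
      exact ⟨⟨i, hi⟩, Finset.mem_univ _, map_pow _ _ _⟩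
    · intro i _
      rfl

theorem IsTransversalFamily.mem_topClass {N : ℕ} (hN : 0 < N) {g : Fin N → ConvSeries}
    (hg : IsTransversalFamily g) : ∏ i, g i ∈ topClass N := by
  have : Nonempty (Fin N) := ⟨⟨0, hN⟩⟩
  obtain ⟨h, hh, hl⟩ := exists_linesEquation_eq_prod hN
  refine ⟨hg.isReducedEquation, ?_⟩
  rw [hl]
  exact hg.equisingular hh (Equiv.refl _)

/-- Every curve equisingular to `N ≥ 2` lines is a union of `N` smooth transversal germs. -/
theorem exists_associated_prod_of_mem_topClass {N : ℕ} (hN : 1 < N) {f : ConvSeries}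
    (hf : f ∈ topClass N) :
    ∃ g : Fin N → ConvSeries, IsTransversalFamily g ∧ Associated (∏ i, g i) f := by
  obtain ⟨hred, heq⟩ := hf
  obtain ⟨h, hh, hl⟩ := exists_linesEquation_eq_prod (zero_lt_one.trans hN)
  rw [hl] at heq
  obtain ⟨e, hsemi, hint⟩ := heq
  let P : Fin N ≃ Branch f := hh.branchEquiv.trans e.symm
  -- Multiplicity one means that two branches generate the maximal ideal.
  have hint' : ∀ i j, i ≠ j → (P i).1 ⊔ (P j).1 = maxIdeal := by
    intro i j hij
    refine eq_maxIdeal_of_finrank_eq_one ?_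
    have hne : P i ≠ P j := fun h => hij (P.injective h)
    change intersectionMultiplicity (P i).1 (P j).1 = 1
    rw [← hint _ _ hne, hh.intersectionMultiplicity_branch]
    exact fun h => hne (e.injective h)
  have hnm : ∀ i, (P i).1 ≠ maxIdeal := by
    intro i hi
    obtain ⟨j, hij⟩ : ∃ j, i ≠ j := by
      have : Nontrivial (Fin N) := Fin.nontrivial_iff_two_le.2 hN
      obtain ⟨j, hj⟩ := exists_ne i
      exact ⟨j, hj.symm⟩
    have hle : (P j).1 ≤ (P i).1 := hi ▸ le_maxIdeal (P j).2.1.1.ne_top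
    have := (P i).2.2 (P j).2.1 hle
    exact hij (P.injective (Subtype.ext (le_antisymm this hle)))
  -- A branch is smooth because its semigroup contains `1`.
  have hex : ∀ i, ∃ g, IsSmooth g ∧ (P i).1 = Ideal.span {g} := by
    intro i
    have h1 : (1 : ℕ) ∈ valueSemigroup (P i).1 := by
      rw [← hsemi, hh.valueSemigroup_branch]; trivial
    obtain ⟨a, -, ha⟩ := h1
    obtain ⟨g, hg, hgs⟩ := exists_isSmooth_mem (eq_maxIdeal_of_finrank_eq_one ha)
    exact ⟨g, hgs, (hgs.eq_span_or_eq_maxIdeal (P i).2.1.1 hg).resolve_right (hnm i)⟩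
  choose g hgs hgP using hex
  have hg : IsTransversalFamily g := by
    refine ⟨hgs, fun i j hij => ?_⟩
    refine transversal_of_sup_eq_maxIdeal (hgs i).evalZero_eq (hgs j).evalZero_eq ?_
    rw [← hgP, ← hgP]
    exact hint' i j hij
  refine ⟨g, hg, associated_of_dvd_dvd (hg.prod_dvd _ fun i _ => ?_) ?_⟩
  · rw [← Ideal.span_singleton_le_span_singleton, ← hgP]
    exact (P i).2.1.2
  · rw [← Ideal.mem_span_singleton, ← hred.isRadical.radical, ← Ideal.sInf_minimalPrimes,
      Submodule.mem_sInf]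
    intro Q hQ
    obtain ⟨i, hi⟩ := P.surjective ⟨Q, hQ⟩
    have : Q = Ideal.span {g i} := by rw [← hgP, hi]
    rw [this, Ideal.mem_span_singleton]
    exact Finset.dvd_prod_of_mem g (Finset.mem_univ i)

/-! ### The blow-up of the origin and leading parts of tangent forms -/

/-- The substitution data `x ↦ X`, `y ↦ t X` of the blow-up of the origin. -/
def blowUpVar : Fin 2 → PowerSeries (Polynomial ℂ) :=
  ![PowerSeries.X, PowerSeries.C Polynomial.X * PowerSeries.X]

theorem hasSubst_blowUpVar : HasSubst blowUpVar := by
  refine hasSubst_of_constantCoeff_zero fun s => ?_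
  change PowerSeries.constantCoeff (blowUpVar s) = 0
  fin_cases s <;> simp [blowUpVar]

/-- The pull-back of power series by the chart `(X, t) ↦ (X, t X)` of the blow-up of the origin.
The coefficient of `X ^ n` is the homogeneous part of degree `n`, evaluated at `(1, t)`. -/
def blowUp : ConvSeries →+* PowerSeries (Polynomial ℂ) :=
  (substAlgHom (R := ℂ) hasSubst_blowUpVar).toRingHom.comp ConvSeries.val.toRingHom

theorem blowUp_var_zero : blowUp (var 0) = PowerSeries.X :=
  substAlgHom_X hasSubst_blowUpVar 0

theorem blowUp_var_one : blowUp (var 1) = PowerSeries.C Polynomial.X * PowerSeries.X :=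
  substAlgHom_X hasSubst_blowUpVar 1

/-- The coefficient of the blow-up at `X ^ n t ^ j` is the coefficient at `x ^ (n - j) y ^ j`. -/
theorem coeff_coeff_blowUp (f : ConvSeries) (n j : ℕ) :
    (PowerSeries.coeff n (blowUp f)).coeff j =
      if j ≤ n then coeff (single 0 (n - j) + single 1 j) (f : MvPowerSeries (Fin 2) ℂ)
      else 0 := by
  classical
  have hprod : ∀ d : Fin 2 →₀ ℕ, PowerSeries.coeff n (d.prod fun s e => blowUpVar s ^ e) =
      if n = d 0 + d 1 then Polynomial.X ^ d 1 else 0 := by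
    intro d
    rw [Finsupp.prod_fintype _ _ (by simp), Fin.prod_univ_two]
    simp only [blowUpVar, Matrix.cons_val_zero, Matrix.cons_val_one]
    rw [mul_pow, mul_left_comm, ← pow_add, ← map_pow, PowerSeries.coeff_C_mul,
      PowerSeries.coeff_X_pow]
    simp
  have h1 : PowerSeries.coeff n (blowUp f) = ∑ᶠ d : Fin 2 →₀ ℕ,
      coeff d (f : MvPowerSeries (Fin 2) ℂ) •
        (if n = d 0 + d 1 then (Polynomial.X : Polynomial ℂ) ^ d 1 else 0) := by
    simp only [← hprod]
    have h0 : blowUp f = subst blowUpVar f.1 := congrFun (coe_substAlgHom hasSubst_blowUpVar) f.1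
    rw [h0]
    exact coeff_subst hasSubst_blowUpVar f.1 (single () n)
  have hfin : {d : Fin 2 →₀ ℕ | n = d 0 + d 1}.Finite := by
    refine Set.Finite.subset (Finset.finite_toSet ((Finset.range (n + 1)).image
      fun j => single 0 (n - j) + single 1 j)) fun d hd => ?_
    simp only [Finset.coe_image, Set.mem_image, Finset.coe_range, Set.mem_Iio]
    simp only [Set.mem_ofPred_eq] at hd
    refine ⟨d 1, by omega, ?_⟩
    ext s
    fin_cases s
    · simp; omega
    · simp
  rw [h1, finsum_eq_sum_of_support_subset (s := hfin.toFinset) _ (by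
    intro d hd
    by_contra h
    apply hd
    rw [Set.Finite.coe_toFinset] at h
    simp only [Set.mem_ofPred_eq] at h
    simp [h]), Polynomial.finsetSum_coeff]
  have h2 : ∀ d ∈ hfin.toFinset, (coeff d (f : MvPowerSeries (Fin 2) ℂ) •
      (if n = d 0 + d 1 then (Polynomial.X : Polynomial ℂ) ^ d 1 else 0)).coeff j =
      if j = d 1 then coeff d (f : MvPowerSeries (Fin 2) ℂ) else 0 := by
    intro d hd
    simp only [Set.Finite.mem_toFinset, Set.mem_ofPred_eq] at hd
    rw [if_pos hd, Polynomial.coeff_smul, Polynomial.coeff_X_pow]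
    simp
  rw [Finset.sum_congr rfl h2]
  split_ifs with hj
  · rw [Finset.sum_eq_single (single 0 (n - j) + single 1 j)]
    · simp
    · intro d hd hne
      rw [if_neg]
      rintro rfl
      apply hne
      simp only [Set.Finite.mem_toFinset, Set.mem_ofPred_eq] at hd
      ext s
      fin_cases s
      · simp; omega
      · simp
    · intro h
      exact (h (by simp; omega)).elim
  · refine Finset.sum_eq_zero fun d hd => if_neg ?_
    simp only [Set.Finite.mem_toFinset, Set.mem_ofPred_eq] at hd
    omega

theorem degree_coeff_blowUp_le (f : ConvSeries) (n : ℕ) :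
    (PowerSeries.coeff n (blowUp f)).degree ≤ n := by
  rw [Polynomial.degree_le_iff_coeff_zero]
  intro j hj
  rw [coeff_coeff_blowUp, if_neg]
  exact not_le.2 (by exact_mod_cast hj)

/-- The order at the origin is the order along the exceptional divisor. -/
theorem X_pow_dvd_blowUp_iff {f : ConvSeries} {n : ℕ} :
    PowerSeries.X ^ n ∣ blowUp f ↔ (n : ℕ∞) ≤ (f : MvPowerSeries (Fin 2) ℂ).order := by
  rw [PowerSeries.X_pow_dvd_iff]
  constructor
  · intro h
    refine nat_le_order fun d hd => ?_
    have hd' : d.degree = d 0 + d 1 := by rw [Finsupp.degree_eq_sum, Fin.sum_univ_two]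
    have := coeff_coeff_blowUp f (d 0 + d 1) (d 1)
    rw [h _ (hd' ▸ hd), if_pos (Nat.le_add_left _ _), Polynomial.coeff_zero] at this
    rw [this, Nat.add_sub_cancel]
    congr 2
    ext s
    fin_cases s <;> simp
  · intro h m hm
    ext j
    rw [coeff_coeff_blowUp, Polynomial.coeff_zero]
    split_ifs with hj
    · refine coeff_of_lt_order ((Nat.cast_lt.2 ?_).trans_le h)
      rw [map_add, Finsupp.degree_single, Finsupp.degree_single]
      omega
    · rfl

theorem coeff_zero_blowUp (f : ConvSeries) :
    PowerSeries.coeff 0 (blowUp f) = Polynomial.C (evalZero f) := by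
  ext j
  rw [coeff_coeff_blowUp, Polynomial.coeff_C, evalZero_apply]
  by_cases hj : j = 0
  · simp [hj]
  · rw [if_neg (by omega), if_neg hj]

theorem coeff_one_blowUp (f : ConvSeries) : PowerSeries.coeff 1 (blowUp f) =
    Polynomial.C (linCoeff 0 f) + Polynomial.C (linCoeff 1 f) * Polynomial.X := by
  ext j
  rw [coeff_coeff_blowUp, Polynomial.coeff_add, Polynomial.coeff_C, Polynomial.coeff_C_mul,
    Polynomial.coeff_X]
  match j with
  | 0 => simp [linCoeff]
  | 1 => simp [linCoeff]
  | j + 2 => simp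

theorem coeff_zero_mul (p q : PowerSeries (Polynomial ℂ)) :
    PowerSeries.coeff 0 (p * q) = PowerSeries.coeff 0 p * PowerSeries.coeff 0 q := by
  simp

theorem coeff_zero_of_blowUp_eq {g : ConvSeries} {γ : PowerSeries (Polynomial ℂ)}
    (hγ : blowUp g = PowerSeries.X * γ) : PowerSeries.coeff 0 γ =
      Polynomial.C (linCoeff 0 g) + Polynomial.C (linCoeff 1 g) * Polynomial.X := by
  have h := PowerSeries.coeff_succ_X_mul 0 γ
  rw [← hγ] at h
  exact h.symm.trans (coeff_one_blowUp g)

theorem wedge_apply (η ω : OneForm) : wedge η ω = ω.1 * η.2 - ω.2 * η.1 := rfl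

/-- The form `ω` is tangent to the germ `g = 0`, that is, logarithmic along it: `g` divides
`ω ∧ dg`. -/
def IsTangent (ω : OneForm) (g : ConvSeries) : Prop := g ∣ wedge (differential g) ω

theorem le_valuation_iff {ω : OneForm} {n : ℕ} : (n : ℕ∞) ≤ valuation ω ↔
    PowerSeries.X ^ n ∣ blowUp ω.1 ∧ PowerSeries.X ^ n ∣ blowUp ω.2 := by
  rw [valuation, le_min_iff, X_pow_dvd_blowUp_iff, X_pow_dvd_blowUp_iff]

/-- The tangency of a form of valuation at least `m` to a smooth germ, in the blow-up and after
division by `X ^ m`. -/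
theorem IsTangent.exists_blowUp {ω : OneForm} {g : ConvSeries} (hω : IsTangent ω g)
    (hg : IsSmooth g) {m : ℕ} {a b γ : PowerSeries (Polynomial ℂ)}
    (ha : blowUp ω.1 = PowerSeries.X ^ m * a) (hb : blowUp ω.2 = PowerSeries.X ^ m * b)
    (hγ : blowUp g = PowerSeries.X * γ) :
    ∃ q, a * blowUp (partialDeriv 1 g) - b * blowUp (partialDeriv 0 g) = γ * q ∧
      (PowerSeries.coeff 0 q).degree < m := by
  obtain ⟨q, hq⟩ := hω
  have hX : (PowerSeries.X : PowerSeries (Polynomial ℂ)) ≠ 0 := PowerSeries.X_ne_zero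
  have h1 : PowerSeries.X ^ m * (a * blowUp (partialDeriv 1 g) - b * blowUp (partialDeriv 0 g)) =
      PowerSeries.X * γ * blowUp q := by
    rw [← hγ, ← map_mul, ← hq, wedge_apply, map_sub, map_mul, map_mul, ha, hb]
    simp only [differential]
    ring
  match m, h1 with
  | 0, h1 =>
    refine ⟨PowerSeries.X * blowUp q, by linear_combination h1, ?_⟩
    simp
  | m + 1, h1 =>
    have hγ0 : ¬ PowerSeries.X ∣ γ := by
      intro h
      rw [PowerSeries.X_dvd_iff] at h
      have h2 := coeff_zero_of_blowUp_eq hγ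
      rw [PowerSeries.coeff_zero_eq_constantCoeff_apply, h] at h2
      have h3 := congrArg (fun p => Polynomial.coeff p 0) h2
      have h4 := congrArg (fun p => Polynomial.coeff p 1) h2
      simp only [Polynomial.coeff_zero, Polynomial.coeff_add, Polynomial.coeff_C_zero,
        Polynomial.coeff_C_mul, Polynomial.coeff_X_zero, mul_zero, add_zero,
        Polynomial.coeff_C_succ, Polynomial.coeff_X_one, mul_one, zero_add] at h3 h4
      rcases (isSmooth_iff.1 hg).2 with h | h
      · exact h h3.symm
      · exact h h4.symm
    have h2 : PowerSeries.X ^ m *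
        (a * blowUp (partialDeriv 1 g) - b * blowUp (partialDeriv 0 g)) = γ * blowUp q := by
      refine mul_left_cancel₀ hX ?_
      linear_combination h1
    obtain ⟨q', hq'⟩ := PowerSeries.X_prime.pow_dvd_of_dvd_mul_left m hγ0
      (Dvd.intro _ h2)
    refine ⟨q', mul_left_cancel₀ (pow_ne_zero m hX) ?_, ?_⟩
    · rw [h2, hq']; ring
    · have h3 := degree_coeff_blowUp_le q m
      rw [hq', PowerSeries.coeff_X_pow_mul', if_pos le_rfl, Nat.sub_self] at h3
      exact h3.trans_lt (by exact_mod_cast Nat.lt_succ_self m)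

/-- A form of valuation at least `m` which is tangent to at least `m + 2` transversal smooth germs
has a radial leading part: the binary form `x A + y B` of degree `m + 1` vanishes on all the
tangent lines. The germs tangent to `x = 0`, which the chart misses, lower the degree instead. -/
theorem IsTransversalFamily.leading_eq_zero {ι : Type*} [Fintype ι] {g : ι → ConvSeries}
    (hg : IsTransversalFamily g) {ω : OneForm} (hω : ∀ i, IsTangent ω (g i)) {m : ℕ}
    (hm : m + 2 ≤ Fintype.card ι) {a b : PowerSeries (Polynomial ℂ)}
    (ha : blowUp ω.1 = PowerSeries.X ^ m * a) (hb : blowUp ω.2 = PowerSeries.X ^ m * b) :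
    PowerSeries.coeff 0 a + Polynomial.X * PowerSeries.coeff 0 b = 0 := by
  classical
  set A := PowerSeries.coeff 0 a with hA
  set B := PowerSeries.coeff 0 b with hB
  have hAdeg : A.degree ≤ m := by
    have := degree_coeff_blowUp_le ω.1 m
    rwa [ha, PowerSeries.coeff_X_pow_mul', if_pos le_rfl, Nat.sub_self] at this
  have hBdeg : B.degree ≤ m := by
    have := degree_coeff_blowUp_le ω.2 m
    rwa [hb, PowerSeries.coeff_X_pow_mul', if_pos le_rfl, Nat.sub_self] at this
  have key : ∀ i, ∃ Q : Polynomial ℂ, Q.degree < m ∧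
      A * Polynomial.C (linCoeff 1 (g i)) - B * Polynomial.C (linCoeff 0 (g i)) =
        (Polynomial.C (linCoeff 0 (g i)) + Polynomial.C (linCoeff 1 (g i)) * Polynomial.X) * Q := by
    intro i
    obtain ⟨γ, hγ⟩ : PowerSeries.X ∣ blowUp (g i) := by
      rw [PowerSeries.X_dvd_iff, ← PowerSeries.coeff_zero_eq_constantCoeff_apply,
        coeff_zero_blowUp, (hg.isSmooth i).evalZero_eq, map_zero]
    obtain ⟨q, hq, hdeg⟩ := (hω i).exists_blowUp (hg.isSmooth i) ha hb hγ
    refine ⟨_, hdeg, ?_⟩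
    have h := congrArg (PowerSeries.coeff 0) hq
    rw [map_sub, coeff_zero_mul, coeff_zero_mul,
      coeff_zero_mul, coeff_zero_blowUp, coeff_zero_blowUp,
      ← linCoeff_eq_evalZero_partialDeriv, ← linCoeff_eq_evalZero_partialDeriv,
      coeff_zero_of_blowUp_eq hγ] at h
    exact h
  choose Q hQdeg hQ using key
  -- The germs whose tangent is visible in the chart `y = t x`.
  let s : Finset ι := Finset.univ.filter fun i => linCoeff 1 (g i) ≠ 0
  have hroot : ∀ i : s, (A + Polynomial.X * B).eval
      (-(linCoeff 0 (g i)) / linCoeff 1 (g i)) = 0 := by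
    rintro ⟨i, hi⟩
    have hi : linCoeff 1 (g i) ≠ 0 := (Finset.mem_filter.1 hi).2
    have h := congrArg (Polynomial.eval (-(linCoeff 0 (g i)) / linCoeff 1 (g i))) (hQ i)
    simp only [Polynomial.eval_sub, Polynomial.eval_mul, Polynomial.eval_add, Polynomial.eval_C,
      Polynomial.eval_X] at h ⊢
    field_simp at h ⊢
    linear_combination h
  have hinj : Function.Injective fun i : s => -(linCoeff 0 (g i)) / linCoeff 1 (g i) := by
    rintro ⟨i, hi⟩ ⟨j, hj⟩ h
    have hi : linCoeff 1 (g i) ≠ 0 := (Finset.mem_filter.1 hi).2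
    have hj : linCoeff 1 (g j) ≠ 0 := (Finset.mem_filter.1 hj).2
    by_contra hne
    apply hg.transversal i j (fun h => hne (Subtype.ext h))
    simp only at h
    rw [div_eq_div_iff hi hj] at h
    linear_combination -h
  have hfinish : ∀ d : ℕ, (A + Polynomial.X * B).degree < (d : WithBot ℕ) → d ≤ s.card →
      A + Polynomial.X * B = 0 := by
    intro d hd hds
    by_contra hne
    refine hne (Polynomial.eq_zero_of_natDegree_lt_card_of_eval_eq_zero _ hinj hroot ?_)
    rw [Fintype.card_coe]
    exact ((Polynomial.natDegree_lt_iff_degree_lt hne).2 hd).trans_le hds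
  by_cases hall : ∀ i, linCoeff 1 (g i) ≠ 0
  · refine hfinish (m + 2) ?_ ?_
    · refine (Polynomial.degree_add_le _ _).trans_lt (max_lt ?_ ?_)
      · exact hAdeg.trans_lt (by exact_mod_cast (by omega : m < m + 2))
      · rw [Polynomial.degree_mul, Polynomial.degree_X]
        calc (1 : WithBot ℕ) + B.degree ≤ 1 + m := by gcongr
          _ < ((m + 2 : ℕ) : WithBot ℕ) := by exact_mod_cast (by omega : 1 + m < m + 2)
    · rwa [show s = Finset.univ from Finset.filter_true_of_mem fun i _ => hall i,
        Finset.card_univ]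
  · push Not at hall
    obtain ⟨i, hi⟩ := hall
    have hi0 : linCoeff 0 (g i) ≠ 0 :=
      ((isSmooth_iff.1 (hg.isSmooth i)).2).resolve_right (not_not.2 hi)
    have hBQ : B = -Q i := by
      have := hQ i
      rw [hi, map_zero, mul_zero, zero_mul, add_zero] at this
      have hC : Polynomial.C (linCoeff 0 (g i)) ≠ 0 := Polynomial.C_ne_zero.2 hi0
      refine mul_left_cancel₀ hC ?_
      linear_combination -this
    have hs : s = Finset.univ.erase i := by
      ext j
      simp only [s, Finset.mem_filter, Finset.mem_univ, true_and, Finset.mem_erase, and_true]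
      constructor
      · rintro h rfl
        exact h hi
      · intro hne h
        exact hg.transversal j i hne (by rw [hi, h]; ring)
    refine hfinish (m + 1) ?_ ?_
    · refine (Polynomial.degree_add_le _ _).trans_lt (max_lt ?_ ?_)
      · exact hAdeg.trans_lt (by exact_mod_cast Nat.lt_succ_self m)
      · rw [hBQ, mul_neg, Polynomial.degree_neg, Polynomial.degree_mul, Polynomial.degree_X,
          Nat.cast_add, add_comm]
        by_cases h0 : Q i = 0
        · rw [h0, Polynomial.degree_zero, WithBot.bot_add]; exact WithBot.bot_lt_coe _
        · have := hQdeg i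
          rw [Polynomial.degree_eq_natDegree h0] at this ⊢
          norm_cast at this ⊢
          omega
    · rw [hs, Finset.card_erase_of_mem (Finset.mem_univ i), Finset.card_univ]
      omega

/-! ### The upper bound for the Saito number -/

theorem mem_saitoModule_iff {f : ConvSeries} {ω : OneForm} :
    ω ∈ saitoModule f ↔ IsTangent ω f := by
  rw [saitoModule, Submodule.mem_comap, Ideal.mem_span_singleton, IsTangent]

theorem wedge_differential_mul (f g : ConvSeries) (ω : OneForm) :
    wedge (differential (f * g)) ω =
      f * wedge (differential g) ω + g * wedge (differential f) ω := by
  simp only [wedge_apply, differential, partialDeriv_mul]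
  ring

theorem IsTangent.mul {ω : OneForm} {f g : ConvSeries} (hf : IsTangent ω f)
    (hg : IsTangent ω g) : IsTangent ω (f * g) := by
  rw [IsTangent, wedge_differential_mul]
  refine dvd_add (mul_dvd_mul_left f hg) ?_
  rw [mul_comm f g]
  exact mul_dvd_mul_left g hf

theorem IsTangent.prod {ι : Type*} {ω : OneForm} {g : ι → ConvSeries} {s : Finset ι}
    (h : ∀ i ∈ s, IsTangent ω (g i)) : IsTangent ω (∏ i ∈ s, g i) :=
  Finset.prod_induction g (IsTangent ω) (fun _ _ => IsTangent.mul) (one_dvd _) h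

theorem IsTangent.of_associated {ω : OneForm} {f g : ConvSeries} (h : IsTangent ω f)
    (hfg : Associated f g) : IsTangent ω g := by
  obtain ⟨u, rfl⟩ := hfg
  exact h.mul u.isUnit.dvd

/-- A form tangent to a union of transversal smooth germs is tangent to each of them. -/
theorem IsTransversalFamily.isTangent_of_isTangent_prod {ι : Type*} [Fintype ι]
    {g : ι → ConvSeries} (hg : IsTransversalFamily g) {ω : OneForm}
    (hω : IsTangent ω (∏ i, g i)) (i : ι) : IsTangent ω (g i) := by
  classical
  rw [← Finset.mul_prod_erase _ _ (Finset.mem_univ i), IsTangent, wedge_differential_mul] at hω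
  have h1 : g i ∣ (∏ j ∈ Finset.univ.erase i, g j) * wedge (differential (g i)) ω :=
    (dvd_add_right (dvd_mul_right _ _)).1 ((dvd_mul_right _ _).trans hω)
  refine ((hg.isSmooth i).prime.dvd_or_dvd h1).resolve_left fun h => ?_
  simpa using hg.dvd_of_dvd_prod h

theorem IsTangent.smul {ω : OneForm} {f : ConvSeries} (h : IsTangent ω f) (c : ConvSeries) :
    IsTangent (c • ω) f := by
  rw [IsTangent, map_smul]
  exact h.mul_left c

theorem IsTangent.sub {ω η : OneForm} {f : ConvSeries} (h : IsTangent ω f)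
    (h' : IsTangent η f) : IsTangent (ω - η) f := by
  rw [IsTangent, map_sub]
  exact dvd_sub h h'

/-- A pair of forms, tangent to all the germs of a finite family of smooth germs, whose exterior
product is the product of their equations. It is built by adding one germ `g` at a time: as
divisibility modulo `g` is total, the restriction of one form to `g` is a multiple of that of the
other, which can thus be made tangent to `g` by subtracting a multiple of the first; the first is
multiplied by `g`. -/
theorem exists_isTangent_wedge_eq_prod {ι : Type*} {g : ι → ConvSeries}
    (hg : ∀ i, IsSmooth (g i)) (s : Finset ι) :
    ∃ ω η : OneForm, (∀ i ∈ s, IsTangent ω (g i)) ∧ (∀ i ∈ s, IsTangent η (g i)) ∧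
      wedge η ω = ∏ i ∈ s, g i := by
  classical
  induction s using Finset.induction_on with
  | empty => exact ⟨(1, 0), (0, 1), by simp, by simp, by simp [wedge_apply]⟩
  | insert i s hi ih =>
    obtain ⟨ω, η, hω, hη, hprod⟩ := ih
    have hself : ∀ θ : OneForm, IsTangent (g i • θ) (g i) := fun θ => by
      rw [IsTangent, map_smul, smul_eq_mul]
      exact dvd_mul_right _ _
    simp only [Finset.forall_mem_insert, Finset.prod_insert hi]
    obtain ⟨h, hh | hh⟩ := (hg i).dvd_sub_mul_total (wedge (differential (g i)) ω)
      (wedge (differential (g i)) η)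
    · refine ⟨ω - h • η, g i • η, ⟨?_, fun j hj => (hω j hj).sub ((hη j hj).smul h)⟩,
        ⟨hself η, fun j hj => (hη j hj).smul _⟩, ?_⟩
      · rw [IsTangent, map_sub, map_smul, smul_eq_mul]
        exact hh
      · rw [← hprod]
        simp only [wedge_apply, Prod.fst_sub, Prod.snd_sub, Prod.smul_fst, Prod.smul_snd,
          smul_eq_mul]
        ring
    · refine ⟨g i • ω, η - h • ω, ⟨hself ω, fun j hj => (hω j hj).smul _⟩,
        ⟨?_, fun j hj => (hη j hj).sub ((hω j hj).smul h)⟩, ?_⟩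
      · rw [IsTangent, map_sub, map_smul, smul_eq_mul]
        exact hh
      · rw [← hprod]
        simp only [wedge_apply, Prod.fst_sub, Prod.snd_sub, Prod.smul_fst, Prod.smul_snd,
          smul_eq_mul]
        ring

theorem order_prod_le {ι : Type*} [Fintype ι] {g : ι → ConvSeries} (hg : ∀ i, IsSmooth (g i)) :
    ((∏ i, g i : ConvSeries) : MvPowerSeries (Fin 2) ℂ).order ≤ Fintype.card ι := by
  have h1 : ∀ i, (g i : MvPowerSeries (Fin 2) ℂ).order ≤ 1 := by
    intro i
    obtain ⟨j, -, hj⟩ := hg i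
    refine (order_le hj).trans ?_
    rw [Finsupp.degree_single]
    rfl
  rw [SubmonoidClass.coe_finsetProd, MvPowerSeries.order_prod]
  refine (Finset.sum_le_sum fun i _ => h1 i).trans ?_
  simp

/-- Among the forms tangent to `N` transversal smooth germs, some have valuation at most
`max 1 ((N - 1) / 2)`. Otherwise the orders in `exists_isTangent_wedge_eq_prod` leave only the case
of an even `N` and two forms of valuation `N / 2`, whose leading parts are both radial, so that
the exterior product has too large an order. -/
theorem IsTransversalFamily.exists_valuation_le {ι : Type*} [Fintype ι] {g : ι → ConvSeries}
    (hg : IsTransversalFamily g) :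
    ∃ ω, (∀ i, IsTangent ω (g i)) ∧
      valuation ω ≤ (max 1 ((Fintype.card ι - 1) / 2) : ℕ) := by
  by_contra! hcon
  obtain ⟨ω, η, hω, hη, hprod⟩ := exists_isTangent_wedge_eq_prod hg.isSmooth Finset.univ
  simp only [Finset.mem_univ, forall_const] at hω hη
  obtain ⟨m, hm⟩ : ∃ m, m = max 1 ((Fintype.card ι - 1) / 2) + 1 := ⟨_, rfl⟩
  have hval : ∀ θ, (∀ i, IsTangent θ (g i)) → (m : ℕ∞) ≤ valuation θ := by
    intro θ hθ
    rw [hm, Nat.cast_add, Nat.cast_one]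
    exact Order.add_one_le_of_lt (hcon θ hθ)
  obtain ⟨⟨a, ha⟩, ⟨b, hb⟩⟩ := le_valuation_iff.1 (hval ω hω)
  obtain ⟨⟨c, hc⟩, ⟨d, hd⟩⟩ := le_valuation_iff.1 (hval η hη)
  have hblow : blowUp (∏ i, g i) = PowerSeries.X ^ (2 * m) * (a * d - b * c) := by
    rw [← hprod, wedge_apply, map_sub, map_mul, map_mul, ha, hb, hc, hd]
    ring
  have hle : ∀ n : ℕ, PowerSeries.X ^ n ∣ blowUp (∏ i, g i) → n ≤ Fintype.card ι := by
    intro n hn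
    exact_mod_cast (X_pow_dvd_blowUp_iff.1 hn).trans (order_prod_le hg.isSmooth)
  -- `2 m ≤ N` where `N ≤ 2 m` by the choice of `m`, so that `N = 2 m` and `m ≥ 2`.
  have h1 := hle _ (Dvd.intro _ hblow.symm)
  have h2 := hg.leading_eq_zero hω (by omega) ha hb
  have h3 := hg.leading_eq_zero hη (by omega) hc hd
  have h4 : PowerSeries.X ∣ a * d - b * c := by
    rw [PowerSeries.X_dvd_iff, ← PowerSeries.coeff_zero_eq_constantCoeff_apply, map_sub,
      coeff_zero_mul, coeff_zero_mul]
    linear_combination (PowerSeries.coeff 0 d) * h2 - (PowerSeries.coeff 0 b) * h3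
  have h5 := hle (2 * m + 1) (by
    rw [hblow, pow_succ]
    exact mul_dvd_mul_left _ h4)
  omega

theorem saitoNumber_le {N : ℕ} (hN : 1 < N) {f : ConvSeries} (hf : f ∈ topClass N) :
    saitoNumber f ≤ (max 1 ((N - 1) / 2) : ℕ) := by
  obtain ⟨g, hg, hfg⟩ := exists_associated_prod_of_mem_topClass hN hf
  obtain ⟨ω, hω, hv⟩ := hg.exists_valuation_le
  rw [Fintype.card_fin] at hv
  refine (sInf_le (Set.mem_image_of_mem valuation ?_)).trans hv
  exact mem_saitoModule_iff.2 ((IsTangent.prod fun i _ => hω i).of_associated hfg)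

/-! ### A dicritical foliation and its leaves -/

theorem partialDeriv_pow (i : Fin 2) (f : ConvSeries) (n : ℕ) :
    partialDeriv i (f ^ n) = n * f ^ (n - 1) * partialDeriv i f := by
  refine Subtype.ext (((MvPowerSeries.pderiv ℂ i).leibniz_pow f.1 n).trans ?_)
  rw [nsmul_eq_mul, smul_eq_mul, ← mul_assoc]
  rfl

theorem partialDeriv_var (i j : Fin 2) : partialDeriv i (var j) = if i = j then 1 else 0 := by
  refine Subtype.ext ((pderiv_X i j).trans ?_)
  by_cases h : i = j
  · subst h; simp
  · simp [h, Ne.symm h]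

theorem partialDeriv_one (i : Fin 2) : partialDeriv i 1 = 0 := by
  rw [← map_one (algebraMap ℂ ConvSeries), partialDeriv_algebraMap]

theorem partialDeriv_eq_zero_iff {i : Fin 2} {f : ConvSeries} : partialDeriv i f = 0 ↔
    ∀ n : Fin 2 →₀ ℕ, n i ≠ 0 → coeff n (f : MvPowerSeries (Fin 2) ℂ) = 0 := by
  constructor
  · intro h n hn
    obtain ⟨m, rfl⟩ : ∃ m, n = m + single i 1 := by
      obtain ⟨m, rfl⟩ := exists_add_of_le (show single i 1 ≤ n by
        rw [Finsupp.single_le_iff]; omega)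
      exact ⟨m, add_comm _ _⟩
    have h1 : coeff m (MvPowerSeries.pderiv ℂ i f.1) = 0 := by
      have := congrArg (fun p : ConvSeries => coeff m (p : MvPowerSeries (Fin 2) ℂ)) h
      simpa [partialDeriv] using this
    rw [coeff_pderiv] at h1
    exact (mul_eq_zero.1 h1).resolve_right (Nat.cast_add_one_ne_zero _)
  · intro h
    refine Subtype.ext (MvPowerSeries.ext fun n => ?_)
    change coeff n (MvPowerSeries.pderiv ℂ i f.1) = coeff n 0
    rw [coeff_pderiv, h _ (by simp), zero_mul, map_zero]

/-- A `k`-th root of `1 - k a x` in `ℂ{x}`. It is the solution of `(1 + y) ^ k = 1 - k a x`,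
obtained as the remainder of the division of `1 + y` by `(1 + y) ^ k - 1 + k a x`. -/
theorem exists_pow_eq_one_sub {k : ℕ} (hk : k ≠ 0) (a : ℂ) :
    ∃ h : ConvSeries, partialDeriv 1 h = 0 ∧ evalZero h = 1 ∧
      h ^ k = 1 - algebraMap ℂ ConvSeries (k * a) * var 0 := by
  set b := algebraMap ℂ ConvSeries (k * a) with hb
  have hb0 : ∀ i, partialDeriv i b = 0 := fun i => partialDeriv_algebraMap i _
  set G : ConvSeries := (1 + var 1) ^ k - 1 + b * var 0 with hG
  have hGs : IsSmoothAlong 1 G := by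
    constructor
    · simp [hG, evalZero_var]
    · rw [linCoeff_eq_evalZero_partialDeriv, hG]
      simp only [partialDeriv_add, partialDeriv_sub, partialDeriv_pow, partialDeriv_mul,
        partialDeriv_one, partialDeriv_var, map_add, map_sub, map_mul, map_pow, map_natCast,
        hb0, evalZero_var]
      simpa using hk
  obtain ⟨q, h, hq, hS⟩ := exists_weierstrass_division (i := 1) (j := 0) (g := G) (by simp)
    hGs.evalZero_eq hGs.linCoeff_ne (1 + var 1)
  rw [← partialDeriv_eq_zero_iff] at hS
  have h1 : evalZero h = 1 := by
    have := congrArg evalZero hq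
    rw [map_add, map_add, map_mul, hGs.evalZero_eq, map_one, evalZero_var] at this
    linear_combination -this
  refine ⟨h, hS, h1, ?_⟩
  have hZ : partialDeriv 1 (h ^ k - 1 + b * var 0) = 0 := by
    simp [partialDeriv_add, partialDeriv_sub, partialDeriv_pow, partialDeriv_mul,
      partialDeriv_one, partialDeriv_var, hb0, hS]
  have hdvd : G ∣ h ^ k - 1 + b * var 0 := by
    have h2 : G ∣ (1 + var 1) ^ k - h ^ k :=
      (Dvd.intro_left q (by rw [hq]; ring)).trans (sub_dvd_pow_sub_pow (1 + var 1) h k)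
    have h3 : h ^ k - 1 + b * var 0 = G - ((1 + var 1) ^ k - h ^ k) := by rw [hG]; ring
    rw [h3]
    exact dvd_sub_self_left.2 h2
  rcases eq_zero_or_eq_var_pow_mul_isUnit (i := 1) (j := 0) (by simp)
    (partialDeriv_eq_zero_iff.1 hZ) with h0 | ⟨n, u, hu, h0⟩
  · linear_combination h0
  · rw [h0, hu.dvd_mul_right] at hdvd
    exact (hGs.not_dvd_var_pow (by simp) n hdvd).elim

/-- The series `h` in the variable `x` with `h(0) = 1` and `h ^ k = 1 - k c ^ (-k) x`. The graph
`y = c x h` is the leaf with tangent `y = c x` of the foliation `modelForm k`. -/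
structure IsLeafFactor (k : ℕ) (c : ℂ) (h : ConvSeries) : Prop where
  partialDeriv_one_eq : partialDeriv 1 h = 0
  evalZero_eq : evalZero h = 1
  pow_eq : h ^ k = 1 - algebraMap ℂ ConvSeries (k * (c ^ k)⁻¹) * var 0

/-- The equation of the graph `y = c x h`. -/
def graphEquation (c : ℂ) (h : ConvSeries) : ConvSeries :=
  var 1 - algebraMap ℂ ConvSeries c * var 0 * h

/-- The dicritical form `(x ^ (k + 1) - y ^ k) dx + x y ^ (k - 1) dy`, whose leading part is
`y ^ (k - 1) (x dy - y dx)` and which has the first integral `(y / x) ^ k + k x`. -/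
def modelForm (k : ℕ) : OneForm := (var 0 ^ (k + 1) - var 1 ^ k, var 0 * var 1 ^ (k - 1))

namespace IsLeafFactor

variable {k : ℕ} {c : ℂ} {h : ConvSeries}

theorem linCoeff_zero (hh : IsLeafFactor k c h) (hk : k ≠ 0) : linCoeff 0 h = -(c ^ k)⁻¹ := by
  obtain ⟨b, hb⟩ : ∃ b, b = algebraMap ℂ ConvSeries (k * (c ^ k)⁻¹) := ⟨_, rfl⟩
  have hb0 : partialDeriv 0 b = 0 := by rw [hb, partialDeriv_algebraMap]
  have hb1 : evalZero b = k * (c ^ k)⁻¹ := by rw [hb, evalZero_algebraMap]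
  have h1 := congrArg (fun f => evalZero (partialDeriv 0 f)) hh.pow_eq
  simp only [← hb, partialDeriv_sub, partialDeriv_pow, partialDeriv_mul, partialDeriv_one,
    partialDeriv_var, hb0, hb1, map_mul, map_pow, map_natCast, hh.evalZero_eq, if_true,
    one_pow, mul_one, mul_zero, zero_sub, add_zero, map_neg,
    ← linCoeff_eq_evalZero_partialDeriv] at h1
  have hk' : (k : ℂ) ≠ 0 := Nat.cast_ne_zero.2 hk
  refine mul_left_cancel₀ hk' ?_
  linear_combination h1

theorem linCoeff_one (hh : IsLeafFactor k c h) : linCoeff 1 h = 0 := by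
  rw [linCoeff_eq_evalZero_partialDeriv, hh.partialDeriv_one_eq, map_zero]

theorem partialDeriv_one_graphEquation (hh : IsLeafFactor k c h) :
    partialDeriv 1 (graphEquation c h) = 1 := by
  simp [graphEquation, partialDeriv_sub, partialDeriv_mul, partialDeriv_var,
    partialDeriv_algebraMap, hh.partialDeriv_one_eq]

theorem partialDeriv_zero_graphEquation (c : ℂ) (h : ConvSeries) :
    partialDeriv 0 (graphEquation c h) =
      -(algebraMap ℂ ConvSeries c * (h + var 0 * partialDeriv 0 h)) := by
  simp only [graphEquation, partialDeriv_sub, partialDeriv_mul, partialDeriv_var,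
    partialDeriv_algebraMap, if_true, zero_ne_one, if_false]
  ring

/-- The leaves of the model form are tangent to it. -/
theorem isTangent_modelForm (hh : IsLeafFactor k c h) (hk : k ≠ 0) (hc : c ≠ 0) :
    IsTangent (modelForm k) (graphEquation c h) := by
  obtain ⟨k, rfl⟩ := Nat.exists_eq_succ_of_ne_zero hk
  obtain ⟨r, hr⟩ : ∃ r : ConvSeries, r = algebraMap ℂ ConvSeries c * var 0 * h := ⟨_, rfl⟩
  obtain ⟨d, hd⟩ : ∃ d : ConvSeries, d = algebraMap ℂ ConvSeries (c ^ (k + 1)) := ⟨_, rfl⟩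
  have hd0 : partialDeriv 0 d = 0 := by rw [hd, partialDeriv_algebraMap]
  have hrk : r ^ (k + 1) = d * var 0 ^ (k + 1) - ((k + 1 : ℕ) : ConvSeries) * var 0 ^ (k + 2) := by
    have h1 : d * algebraMap ℂ ConvSeries (((k + 1 : ℕ) : ℂ) * (c ^ (k + 1))⁻¹) =
        ((k + 1 : ℕ) : ConvSeries) := by
      rw [hd, ← map_mul, mul_left_comm, mul_inv_cancel₀ (pow_ne_zero _ hc), mul_one, map_natCast]
    rw [hr, mul_pow, mul_pow, hh.pow_eq, ← map_pow, ← hd]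
    linear_combination (-(var 0 ^ (k + 2))) * h1
  -- The derivative of `r ^ (k + 1)`, divided by `k + 1`.
  have hdr : var 0 * r ^ k * partialDeriv 0 r =
      d * var 0 ^ (k + 1) - ((k : ConvSeries) + 2) * var 0 ^ (k + 2) := by
    have h1 := congrArg (partialDeriv 0) hrk
    have h2 : partialDeriv 0 ((k + 1 : ℕ) : ConvSeries) = 0 := by
      rw [← map_natCast (algebraMap ℂ ConvSeries), partialDeriv_algebraMap]
    simp only [partialDeriv_sub, partialDeriv_pow, partialDeriv_mul, partialDeriv_var, h2, hd0,
      if_true, Nat.add_sub_cancel, show k + 2 - 1 = k + 1 from rfl] at h1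
    have hk' : ((k + 1 : ℕ) : ConvSeries) ≠ 0 := by
      rw [← map_natCast (algebraMap ℂ ConvSeries)]
      exact (map_ne_zero _).2 (Nat.cast_ne_zero.2 (Nat.succ_ne_zero k))
    refine mul_left_cancel₀ hk' ?_
    push_cast at h1 ⊢
    linear_combination (var 0) * h1
  have hdr' : partialDeriv 0 (graphEquation c h) = -partialDeriv 0 r := by
    rw [partialDeriv_zero_graphEquation, hr]
    simp only [partialDeriv_mul, partialDeriv_var, partialDeriv_algebraMap, if_true]
    ring
  have hw : wedge (differential (graphEquation c h)) (modelForm (k + 1)) =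
      var 0 * partialDeriv 0 r * (var 1 ^ k - r ^ k) - (var 1 ^ (k + 1) - r ^ (k + 1)) := by
    rw [wedge_apply]
    simp only [differential, modelForm, hh.partialDeriv_one_graphEquation, hdr',
      Nat.add_sub_cancel]
    push_cast at hrk
    linear_combination hdr - hrk
  rw [IsTangent, hw, show graphEquation c h = var 1 - r by rw [hr]; rfl]
  exact dvd_sub ((sub_dvd_pow_sub_pow (var 1) r k).mul_left _) (sub_dvd_pow_sub_pow (var 1) r _)

/-- The second order condition for tangency to a leaf, for a form whose leading part is radial. It
relates the homogeneous parts of degrees `m + 1` and `m`, through the coefficient of `x ^ 2` in the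
equation of the leaf. -/
theorem eval_of_isTangent (hh : IsLeafFactor k c h) (hk : k ≠ 0) (hc : c ≠ 0) {ω : OneForm}
    (hω : IsTangent ω (graphEquation c h)) (hg : IsSmooth (graphEquation c h)) {m : ℕ}
    {a b : PowerSeries (Polynomial ℂ)}
    (ha : blowUp ω.1 = PowerSeries.X ^ m * a) (hb : blowUp ω.2 = PowerSeries.X ^ m * b)
    (h0 : PowerSeries.coeff 0 a + Polynomial.X * PowerSeries.coeff 0 b = 0) :
    c ^ (k - 1) * ((PowerSeries.coeff 1 a).eval c + c * (PowerSeries.coeff 1 b).eval c) =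
      (PowerSeries.coeff 0 b).eval c := by
  have hC : blowUp (algebraMap ℂ ConvSeries c) = PowerSeries.C (Polynomial.C c) :=
    ((substAlgHom (R := ℂ) hasSubst_blowUpVar).commutes c).trans MvPowerSeries.algebraMap_apply
  have hγ : blowUp (graphEquation c h) = PowerSeries.X *
      (PowerSeries.C Polynomial.X - PowerSeries.C (Polynomial.C c) * blowUp h) := by
    rw [graphEquation, map_sub, map_mul, map_mul, blowUp_var_zero, blowUp_var_one, hC]
    ring
  obtain ⟨q, hq, -⟩ := hω.exists_blowUp hg ha hb hγ
  rw [hh.partialDeriv_one_graphEquation, partialDeriv_zero_graphEquation, map_one, map_neg,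
    map_mul, map_add, map_mul, blowUp_var_zero, hC] at hq
  have hl := hh.linCoeff_zero hk
  have hh0 : PowerSeries.constantCoeff (blowUp h) = 1 := by
    rw [← PowerSeries.coeff_zero_eq_constantCoeff_apply, coeff_zero_blowUp, hh.evalZero_eq, map_one]
  have hh1 : PowerSeries.coeff 1 (blowUp h) = Polynomial.C (-(c ^ k)⁻¹) := by
    rw [coeff_one_blowUp, hl, hh.linCoeff_one, map_zero, zero_mul, add_zero]
  have hd0 : PowerSeries.constantCoeff (blowUp (partialDeriv 0 h)) =
      Polynomial.C (-(c ^ k)⁻¹) := by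
    rw [← PowerSeries.coeff_zero_eq_constantCoeff_apply, coeff_zero_blowUp,
      ← linCoeff_eq_evalZero_partialDeriv, hl]
  have e0 := congrArg (PowerSeries.coeff 0) hq
  have e1 := congrArg (PowerSeries.coeff 1) hq
  simp only [PowerSeries.coeff_zero_eq_constantCoeff_apply] at e0 h0 ⊢
  simp only [map_sub, map_add, map_mul, map_neg, map_one, PowerSeries.constantCoeff_X,
    PowerSeries.constantCoeff_C, hh0] at e0
  have hX1 : PowerSeries.coeff 1 (PowerSeries.X : PowerSeries (Polynomial ℂ)) = 1 :=
    PowerSeries.coeff_one_X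
  have hC1 : ∀ p : Polynomial ℂ, PowerSeries.coeff 1 (PowerSeries.C p) = 0 := fun p => by
    rw [PowerSeries.coeff_C, if_neg one_ne_zero]
  have hone : PowerSeries.coeff 1 (1 : PowerSeries (Polynomial ℂ)) = 0 := by
    rw [PowerSeries.coeff_one, if_neg one_ne_zero]
  simp only [map_sub, map_add, map_neg, map_mul, map_one, PowerSeries.coeff_one_mul, hX1, hC1,
    hone, PowerSeries.constantCoeff_X, PowerSeries.constantCoeff_C, hh0, hh1, hd0] at e1
  set A := PowerSeries.constantCoeff a
  set B := PowerSeries.constantCoeff b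
  set Q := PowerSeries.constantCoeff q
  have hne : (Polynomial.X - Polynomial.C c : Polynomial ℂ) ≠ 0 := Polynomial.X_sub_C_ne_zero c
  -- At first order, the radial leading part determines the leading part of the cofactor.
  have hQ : Q = -B := by
    refine mul_left_cancel₀ hne ?_
    linear_combination h0 - e0
  have e2 := congrArg (Polynomial.eval c) e1
  rw [hQ] at e2
  simp only [Polynomial.eval_add, Polynomial.eval_mul, Polynomial.eval_sub, Polynomial.eval_neg,
    Polynomial.eval_C, Polynomial.eval_X, Polynomial.eval_one, Polynomial.eval_zero] at e2
  have hck : c ^ (k - 1) * (c * (c ^ k)⁻¹) = 1 := by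
    rw [← mul_assoc, ← pow_succ, Nat.sub_add_cancel (Nat.pos_of_ne_zero hk),
      mul_inv_cancel₀ (pow_ne_zero _ hc)]
  linear_combination c ^ (k - 1) * e2 + (B.eval c) * hck

end IsLeafFactor

/-! ### Curves with prescribed Saito number -/

theorem isSmoothAlong_graphEquation (c : ℂ) (h : ConvSeries) :
    IsSmoothAlong 1 (graphEquation c h) := by
  constructor
  · simp [graphEquation, evalZero_var]
  · simp [graphEquation, linCoeff_sub, linCoeff_mul, evalZero_var, linCoeff_var]

theorem isTransversalFamily_graphEquation {ι : Type*} {k : ℕ} {c : ι → ℂ} {h : ι → ConvSeries}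
    (hc : Function.Injective c) (hh : ∀ i, IsLeafFactor k (c i) (h i)) :
    IsTransversalFamily fun i => graphEquation (c i) (h i) := by
  refine ⟨fun i => ⟨1, isSmoothAlong_graphEquation _ _⟩, fun i j hij => ?_⟩
  have h0 : ∀ i, linCoeff 0 (graphEquation (c i) (h i)) = -c i := fun i => by
    simp [graphEquation, linCoeff_sub, linCoeff_mul, evalZero_var, linCoeff_var,
      evalZero_algebraMap, (hh i).evalZero_eq]
  have h1 : ∀ i, linCoeff 1 (graphEquation (c i) (h i)) = 1 := fun i => by
    simp [graphEquation, linCoeff_sub, linCoeff_mul, evalZero_var, linCoeff_var]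
  rw [Transversal, h0, h0, h1, h1]
  intro h
  exact hij (hc (by linear_combination -h))

theorem valuation_modelForm_le {k : ℕ} (hk : k ≠ 0) : valuation (modelForm k) ≤ k := by
  refine (min_le_right _ _).trans ?_
  have : coeff (single 0 1 + single 1 (k - 1))
      ((modelForm k).2 : MvPowerSeries (Fin 2) ℂ) ≠ 0 := by
    change coeff _ (X 0 * X 1 ^ (k - 1)) ≠ 0
    rw [X_def, coeff_add_monomial_mul, coeff_X_pow]
    simp
  refine (order_le this).trans ?_
  rw [map_add, Finsupp.degree_single, Finsupp.degree_single]
  exact_mod_cast (by omega : 1 + (k - 1) ≤ k)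

/-- A form tangent to sufficiently many leaves of `modelForm k` has valuation at least `k`. If it
had valuation `m < k`, its leading part `A dx + B dy` would satisfy `x A + y B = 0`, so that
`B(1, t)` has degree less than `m`. The second order terms along the leaves then give a polynomial
`t ^ (k - 1) S(t) - B(1, t)` of degree at most `2 k` which vanishes at the slopes of all leaves and
hence is zero; so `t ^ (k - 1)` divides `B(1, t)`, which forces `B = 0` and `A = 0`. -/
theorem le_valuation_of_isTangent {ι : Type*} [Fintype ι] {k : ℕ} (hk : k ≠ 0) {c : ι → ℂ}
    {h : ι → ConvSeries} (hc : Function.Injective c) (hc0 : ∀ i, c i ≠ 0)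
    (hh : ∀ i, IsLeafFactor k (c i) (h i)) (hcard : k + 1 ≤ Fintype.card ι)
    (hcard' : 2 ≤ k → 2 * k + 1 ≤ Fintype.card ι) {ω : OneForm}
    (hω : ∀ i, IsTangent ω (graphEquation (c i) (h i))) : (k : ℕ∞) ≤ valuation ω := by
  have hg := isTransversalFamily_graphEquation hc hh
  suffices H : ∀ m ≤ k, (m : ℕ∞) ≤ valuation ω from H k le_rfl
  intro m
  induction m with
  | zero => intro _; simp
  | succ m ih =>
    intro hm
    obtain ⟨⟨a, ha⟩, ⟨b, hb⟩⟩ := le_valuation_iff.1 (ih (by omega))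
    have h0 := hg.leading_eq_zero hω (m := m) (by omega) ha hb
    have hdeg : ∀ (f : ConvSeries) (p : PowerSeries (Polynomial ℂ)) (n : ℕ),
        blowUp f = PowerSeries.X ^ m * p → (PowerSeries.coeff n p).degree ≤ (m + n : ℕ) := by
      intro f p n hp
      have := degree_coeff_blowUp_le f (m + n)
      rwa [hp, PowerSeries.coeff_X_pow_mul', if_pos (Nat.le_add_right _ _),
        Nat.add_sub_cancel_left] at this
    have hBdeg : (PowerSeries.coeff 0 b).degree < m := by
      by_cases hB : PowerSeries.coeff 0 b = 0
      · rw [hB, Polynomial.degree_zero]; exact WithBot.bot_lt_coe _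
      have hA := hdeg _ a 0 ha
      rw [show PowerSeries.coeff 0 a = -(Polynomial.X * PowerSeries.coeff 0 b) by
        linear_combination h0, Polynomial.degree_neg, Polynomial.degree_mul, Polynomial.degree_X,
        Polynomial.degree_eq_natDegree hB] at hA
      rw [Polynomial.degree_eq_natDegree hB]
      norm_cast at hA ⊢
      omega
    have hB : PowerSeries.coeff 0 b = 0 := by
      rcases Nat.eq_zero_or_pos m with rfl | hm0
      · exact Polynomial.degree_eq_bot.1 (Nat.WithBot.lt_zero_iff.1 (by simpa using hBdeg))
      set S := PowerSeries.coeff 1 a + Polynomial.X * PowerSeries.coeff 1 b with hS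
      have hSdeg : S.degree ≤ (m + 2 : ℕ) := by
        refine (Polynomial.degree_add_le _ _).trans (max_le ?_ ?_)
        · exact (hdeg _ a 1 ha).trans (by exact_mod_cast (by omega : m + 1 ≤ m + 2))
        · rw [Polynomial.degree_mul, Polynomial.degree_X]
          calc (1 : WithBot ℕ) + (PowerSeries.coeff 1 b).degree ≤ 1 + (m + 1 : ℕ) := by
                gcongr; exact hdeg _ b 1 hb
            _ = ((m + 2 : ℕ) : WithBot ℕ) := by push_cast; ring
      set p := Polynomial.X ^ (k - 1) * S - PowerSeries.coeff 0 b with hp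
      have hroot : ∀ i, p.eval (c i) = 0 := by
        intro i
        have := (hh i).eval_of_isTangent hk (hc0 i) (hω i) (hg.isSmooth i) ha hb h0
        rw [hp, hS]
        simp only [Polynomial.eval_sub, Polynomial.eval_mul, Polynomial.eval_pow,
          Polynomial.eval_add, Polynomial.eval_X]
        linear_combination this
      have hpdeg : p.degree ≤ (2 * k : ℕ) := by
        refine (Polynomial.degree_sub_le _ _).trans (max_le ?_ ?_)
        · rw [Polynomial.degree_mul, Polynomial.degree_X_pow]
          calc ((k - 1 : ℕ) : WithBot ℕ) + S.degree ≤ (k - 1 : ℕ) + (m + 2 : ℕ) := by gcongr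
            _ ≤ ((2 * k : ℕ) : WithBot ℕ) := by
                exact_mod_cast (by omega : k - 1 + (m + 2) ≤ 2 * k)
        · exact hBdeg.le.trans (by exact_mod_cast (by omega : m ≤ 2 * k))
      have hp0 : p = 0 := by
        refine Polynomial.eq_zero_of_natDegree_lt_card_of_eval_eq_zero _ hc hroot ?_
        have := Polynomial.natDegree_le_iff_degree_le.2 hpdeg
        have := hcard' (by omega)
        omega
      refine Polynomial.eq_zero_of_dvd_of_degree_lt (p := Polynomial.X ^ (k - 1)) ⟨S, ?_⟩ ?_
      · linear_combination -hp0
      · rw [Polynomial.degree_X_pow]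
        exact hBdeg.trans_le (by exact_mod_cast (by omega : m ≤ k - 1))
    have hA : PowerSeries.coeff 0 a = 0 := by rw [hB, mul_zero, add_zero] at h0; exact h0
    refine le_valuation_iff.2 ⟨?_, ?_⟩
    · rw [ha, pow_succ]
      refine mul_dvd_mul_left _ (PowerSeries.X_dvd_iff.2 ?_)
      rwa [← PowerSeries.coeff_zero_eq_constantCoeff_apply]
    · rw [hb, pow_succ]
      refine mul_dvd_mul_left _ (PowerSeries.X_dvd_iff.2 ?_)
      rwa [← PowerSeries.coeff_zero_eq_constantCoeff_apply]

theorem exists_saitoNumber_eq {N k : ℕ} (hk : k ≠ 0) (hN : k + 1 ≤ N)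
    (hN' : 2 ≤ k → 2 * k + 1 ≤ N) : ∃ f ∈ topClass N, saitoNumber f = (k : ℕ∞) := by
  -- The slopes of the leaves only have to be distinct and nonzero.
  have hc : Function.Injective fun i : Fin N => ((i : ℕ) + 1 : ℂ) := by
    intro i j hij
    exact Fin.ext (by simpa using hij)
  have hc0 : ∀ i : Fin N, ((i : ℕ) + 1 : ℂ) ≠ 0 := fun i => Nat.cast_add_one_ne_zero _
  have hex : ∀ i : Fin N, ∃ h, IsLeafFactor k ((i : ℕ) + 1 : ℂ) h := fun i => by
    obtain ⟨h, h1, h2, h3⟩ := exists_pow_eq_one_sub hk ((((i : ℕ) + 1 : ℂ) ^ k)⁻¹)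
    exact ⟨h, h1, h2, h3⟩
  choose h hh using hex
  have hg := isTransversalFamily_graphEquation hc hh
  refine ⟨_, hg.mem_topClass (by omega), le_antisymm ?_ ?_⟩
  · refine (sInf_le (Set.mem_image_of_mem valuation ?_)).trans (valuation_modelForm_le hk)
    exact mem_saitoModule_iff.2 (IsTangent.prod fun i _ => (hh i).isTangent_modelForm hk (hc0 i))
  · refine le_sInf ?_
    rintro _ ⟨ω, hω, rfl⟩
    refine le_valuation_of_isTangent hk hc hc0 hh (by simpa using hN) (by simpa using hN') ?_
    exact hg.isTangent_of_isTangent_prod (mem_saitoModule_iff.1 hω)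

end

end PlaneCurve

theorem mainTheorem5 (N : ℕ) (hN : 1 < N) :
    ∃ M : ℕ,
      IsGreatest (PlaneCurve.saitoNumber '' PlaneCurve.topClass N) (M : ℕ∞) ∧
      (N = 2 ∨ N = 3 ∨ N = 4 → M = 1) ∧
      (5 ≤ N → Odd N → M = (N - 1) / 2) ∧
      (5 ≤ N → Even N → M = N / 2 - 1) ∧
      ∀ k : ℕ, 1 ≤ k → k ≤ M →
        ∃ f ∈ PlaneCurve.topClass N, PlaneCurve.saitoNumber f = (k : ℕ∞) := by
  have hex : ∀ k : ℕ, 1 ≤ k → k ≤ max 1 ((N - 1) / 2) →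
      ∃ f ∈ PlaneCurve.topClass N, PlaneCurve.saitoNumber f = (k : ℕ∞) := by
    intro k hk hkM
    exact PlaneCurve.exists_saitoNumber_eq (by omega) (by omega) (by omega)
  refine ⟨max 1 ((N - 1) / 2), ⟨?_, ?_⟩, by omega, by omega, ?_, hex⟩
  · obtain ⟨f, hf, hfs⟩ := hex _ (le_max_left _ _) le_rfl
    exact ⟨f, hf, hfs⟩
  · rintro _ ⟨f, hf, rfl⟩
    exact PlaneCurve.saitoNumber_le hN hf
  · rintro h5 ⟨r, hr⟩
    omega
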